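/- **Setting.** Let $\mathbb{H}$ be the quaternions, $\mathbb{S}=\{I\in\mathbb{H}: I^2=-1\}$, and $\mathbb{H}_{\mathbb{C}}=\mathbb{H}+\imath\mathbb{H}$ the complexified algebra ($\imath^2=-1$, $\imath$ central), with conjugation $\overline{x+\imath y}=x-\imath y$ and with $\mathbb{R}_{\mathbb{C}}=\mathbb{R}+\imath\mathbb{R}\simeq\mathbb{C}$. For $I\in\mathbb{S}$ let $\phi_I:\mathbb{R}_{\mathbb{C}}\to\mathbb{H}$, $\phi_I(\alpha+\imath\beta)=\alpha+\beta I$; for $T\subseteq\mathbb{H}$ let $T_I^{\geqslant}=\{\alpha+\beta I\in T:\beta\ge 0\}$; and let $\mathbb{S}_x=\alpha+\beta\mathbb{S}$ for $x=\alpha+\beta I$. A set is symmetric if it includes $\mathbb{S}_x$ whenever it includes $x$. An open $U\subseteq\mathbb{H}$ is *speared* if, for all $I\in\mathbb{S}$, each connected component of $U_I^{\geqslant}$ includes a real point; a *speared domain* is a nonempty connected speared open set. An open $T\subseteq\mathbb{R}_{\mathbb{C}}$ is speared if each of its connected components intersects the real axis. $\mathrm{core}(\Omega)$ is the largest symmetric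 speared open subset of $\Omega$, and $\mathrm{core}_{\mathbb{R}_{\mathbb{C}}}(\Omega)=\phi_I^{-1}(\mathrm{core}(\Omega))$ (for any $I\in\mathbb{S}$). A function $f:\Omega\to\mathbb{H}$ is *slice regular* if, for each $I\in\mathbb{S}$, the map $(\alpha,\beta)\mapsto f(\alpha+\beta I)$ is $\mathscr{C}^1$ on $\phi_I^{-1}(\Omega)$ and $\frac12\left(\frac{\partial}{\partial\alpha}+I\frac{\partial}{\partial\beta}\right)f(\alpha+\beta I)=0$ there. A *holomorphic stem function* on a conjugation-invariant open set $D\subseteq\mathbb{R}_{\mathbb{C}}$ is a map $F:D\to\mathbb{H}_{\mathbb{C}}$, holomorphic with respect to multiplication by $\imath$, with $F(\bar z)=\overline{F(z)}$. Let $\Omega\subseteq\mathbb{H}$ be a speared domain and let $f:\Omega\to\mathbb{H}$ be slice regular. For $J,K\in\mathbb{S}$ set $D^J=\phi_J^{-1}(\Omega_J^{\geqslant})\cup\overline{\phi_J^{-1}(\Omega_J^{\geqslant})}$, $E^{J,K}=\phi_J^{-1}(\Omega_J^{\geqslant})\cap\phi_K^{-1}(\Omega_K^{\geqslant})$, $D^{J,K}=E^{J,K}\cup\overline{E^{J,K}}$.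 For $J\ne K$ and $z=\alpha+\imath\beta\in E^{J,K}$ set $V^{J,K}(z)=(J-K)^{-1}[Jf(\alpha+\beta J)-Kf(\alpha+\beta K)]$, $W^{J,K}(z)=(J-K)^{-1}[f(\alpha+\beta J)-f(\alpha+\beta K)]$, $F^{J,K}(z)=V^{J,K}(z)+\imath W^{J,K}(z)$ and $F^{J,K}(\bar z)=\overline{F^{J,K}(z)}$. The *holomorphic stem family* $\{F^J:D^J\to\mathbb{H}_{\mathbb{C}}\}_{J\in\mathbb{S}}$ associated to $f$ is $F^J(z)=\lim_{\mathbb{S}\setminus\{J\}\ni K\to J}F^{J,K}(z)$. The *spherical value* of $f$ at $x=\alpha+\beta J_0\in\Omega$ ($\beta\ge0$) is $f^\circ_s(x)=V^{J,K}(\alpha+\imath\beta)$ and, if $\beta>0$, the *spherical derivative* is $f'_s(x)=\beta^{-1}W^{J,K}(\alpha+\imath\beta)$, for any distinct $J,K\in\mathbb{S}$ with $\alpha+\beta J,\alpha+\beta K\in\Lambda$. Here $\Lambda$ is any speared open subset of $\Omega$, including $\mathrm{core}(\Omega)\cup\Omega_{J_0}^{\geqslant}$, such that $f(a+bI)=V^{J,K}(a+\imath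 b)+I\,W^{J,K}(a+\imath b)$ for all $I,J,K\in\mathbb{S}$ with $J\ne K$ and all $a\in\mathbb{R}$, $b\ge0$ with $a+bI,a+bJ,a+bK\in\Lambda$. *Hinged points.* If $x_0=\alpha+\beta J_0$, $x_1=\alpha+\beta J_1$, $y_0=\alpha'+\beta'J_0$, $y_1=\alpha'+\beta'J_1$ (with $\beta,\beta'\ge0$) all belong to $\Omega$, then $(x_1,y_1)$ *shadows* $(x_0,y_0)$ if there is a path in $E^{J_0,J_1}$ from $\alpha+\imath\beta$ to $\alpha'+\imath\beta'$; and $x_1$ is *strongly hinged* to $x_0$ if $(x_1,y)$ shadows $(x_0,y)$ for some $y\in\Omega\cap\mathbb{R}$. Given a finite sequence $\{x_s\}_{s=0}^t$ in $\Omega$ ($t\ge1$) with index set $T=\{0,\dots,t\}$, and $s,s'\in T$ with $|s-s'|=1$, there is a *simple step* at $\min\{s,s'\}$ if (1) $x_{s'}$ belongs to the connected component of $\mathbb{S}_{x_s}\cap\Omega$ including $x_s$, or (2) $x_{s'}$ is strongly hinged to $x_s$. If (1) and (2) are false, but there exist $s'',s'''\in T\setminus\{s,s'\}$ with $s''-s'''=s'-s$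 such that $(x_{s''},x_{s'''})$ shadows $(x_s,x_{s'})$, then there is a *double step* at $(\min\{s,s',s'',s'''\},\max\{s,s',s'',s'''\}-1)$. The sequence is a *chain* connecting $x_0$ and $x_t$ if the indices in $T\setminus\{t\}$ at which no simple step happens can be listed without repetitions as $\underline{s}_1,\overline{s}_1,\dots,\underline{s}_\ell,\overline{s}_\ell$ in such a way that a double step happens at each $(\underline{s}_m,\overline{s}_m)$, that $\underline{s}_1<\dots<\underline{s}_\ell$, and that $m<n$ implies $\overline{s}_m<\underline{s}_n$ or $\overline{s}_m>\overline{s}_n$. One writes $x\sim x'$ if some chain connects $x$ and $x'$. **Theorem.** Let $\Omega\subseteq\mathbb{H}$ be a speared domain and let $f:\Omega\to\mathbb{H}$ be a slice regular function. (a) The objects above are well defined. Each $F^J$ is a holomorphic stem function on $D^J$. For each $J\in\mathbb{S}$ and each $z\in D^J$ there are $\varepsilon>0$ and a speared open neighbourhood $U_z$ of $z$ in $D^J$ such that $\mathrm{core}_{\mathbb{R}_{\mathbb{C}}}(\Omega)\subseteq U_z$; such that $U_z\setminus\mathrm{core}_{\mathbb{R}_{\mathbb{C}}}(\Omega)$ is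 contained in the open upper or in the open lower half-plane; and such that $U_z\subseteq D^{J',K'}$ and $F^{J',K'}=F^J$ in $U_z$ for all distinct $J',K'\in\mathbb{S}$ with $|J'-J|,|K'-J|<\varepsilon$. For all $J,J',K'\in\mathbb{S}$ with $J'\neq K'$, $F^{J',K'}=F^J$ in $\mathrm{core}_{\mathbb{R}_{\mathbb{C}}}(\Omega)$. The spherical value $f^\circ_s(x)$ exists and is unique for every $x\in\Omega$, and so is the spherical derivative $f'_s(x)$ for every $x\in\Omega\setminus\mathbb{R}$. (b) Let $\alpha_0,\beta_0\in\mathbb{R}$ with $\beta_0\ge0$ and $I,I'\in\mathbb{S}$ be such that $x=\alpha_0+\beta_0I$ and $x'=\alpha_0+\beta_0I'$ belong to $\Omega$. If $x\sim x'$, then there exists an open neighbourhood $U$ of $\alpha_0+\beta_0\imath$ in $D^{I,I'}$ where $F^I$ and $F^{I'}$ coincide. Moreover, for all $\alpha,\beta\in\mathbb{R}$ with $\beta\ge0$ and $\alpha+\beta\imath\in U$, the equality $f^\circ_s(\alpha+\beta I)=f^\circ_s(\alpha+\beta I')$ holds and, provided $\beta>0$, the equality $f'_s(\alpha+\beta I)=f'_s(\alpha+\beta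 I')$ holds. -/

import Mathlib

open scoped Quaternion Topology

noncomputable section

/-- The sphere `𝕊` of quaternionic imaginary units, `{w ∈ ℍ | w² = -1}`. -/
def imagUnits : Set ℍ[ℝ] := {w | w ^ 2 = -1}

/-- The map `φ_I : α + ı β ↦ α + β I`. The set `ℝ_ℂ = ℝ + ı ℝ` is identified with `ℂ`. -/
def slicePoint (I : imagUnits) (z : ℂ) : ℍ[ℝ] := ((z.re : ℝ) : ℍ[ℝ]) + z.im • (I : ℍ[ℝ])

/-- The sphere `𝕊_x = α + β 𝕊` through `x = α + β I`. -/
def sphereThrough (x : ℍ[ℝ]) : Set ℍ[ℝ] :=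
  {y | ∃ (z : ℂ) (I J : imagUnits), x = slicePoint I z ∧ y = slicePoint J z}

/-- Axially symmetric sets. -/
def IsAxiallySymmetric (T : Set ℍ[ℝ]) : Prop := ∀ x ∈ T, sphereThrough x ⊆ T

/-- The closed half-plane `ℂ_I^≥ = {α + β I | β ≥ 0}`. -/
def halfPlane (I : imagUnits) : Set ℍ[ℝ] := {x | ∃ z : ℂ, 0 ≤ z.im ∧ x = slicePoint I z}

/-- `T_I^≥ = T ∩ ℂ_I^≥`. -/
def halfSlice (T : Set ℍ[ℝ]) (I : imagUnits) : Set ℍ[ℝ] := T ∩ halfPlane I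

/-- Speared open subsets of `ℍ`: for every `I ∈ 𝕊`, each connected component of `U_I^≥`
includes a real point. -/
def IsSpearedOpen (U : Set ℍ[ℝ]) : Prop :=
  IsOpen U ∧ ∀ I : imagUnits, ∀ x ∈ halfSlice U I,
    ∃ a : ℝ, (a : ℍ[ℝ]) ∈ connectedComponentIn (halfSlice U I) x

/-- Speared domains: nonempty connected speared open subsets of `ℍ`. -/
def IsSpearedDomain (Ω : Set ℍ[ℝ]) : Prop := IsConnected Ω ∧ IsSpearedOpen Ω

/-- Speared open subsets of `ℝ_ℂ`: all connected components intersect the real axis. -/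
def IsSpearedOpenC (T : Set ℂ) : Prop :=
  IsOpen T ∧ ∀ z ∈ T, ∃ a : ℝ, (a : ℂ) ∈ connectedComponentIn T z

/-- The core of `U`: the largest symmetric speared open subset of `U`, i.e., the union of all
symmetric speared open subsets of `U`. -/
def core (U : Set ℍ[ℝ]) : Set ℍ[ℝ] :=
  ⋃₀ {V | IsSpearedOpen V ∧ IsAxiallySymmetric V ∧ V ⊆ U}

/-- The conjugation-invariant subset of `ℝ_ℂ` whose circularization is `core U`. -/
def coreC (U : Set ℍ[ℝ]) : Set ℂ := {z | ∃ J : imagUnits, slicePoint J z ∈ core U}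

/-- `∂̄_I f = ½ (∂/∂α + I ∂/∂β) (f ∘ φ_I)`, as a function of `α + ı β`. -/
def dbarSlice (I : imagUnits) (f : ℍ[ℝ] → ℍ[ℝ]) (z : ℂ) : ℍ[ℝ] :=
  (1 / 2 : ℝ) • (fderiv ℝ (fun w : ℂ => f (slicePoint I w)) z 1
    + (I : ℍ[ℝ]) * fderiv ℝ (fun w : ℂ => f (slicePoint I w)) z Complex.I)

/-- Slice regularity of `f` on an open set `Ω` (only the values of `f` on `Ω` matter): for every
`I ∈ 𝕊`, the restriction of `f` to `Ω ∩ ℂ_I` is `C¹` and is annihilated by `∂̄_I`. -/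
def IsSliceRegular (Ω : Set ℍ[ℝ]) (f : ℍ[ℝ] → ℍ[ℝ]) : Prop :=
  ∀ I : imagUnits,
    ContDiffOn ℝ 1 (fun w : ℂ => f (slicePoint I w)) (slicePoint I ⁻¹' Ω) ∧
    ∀ z ∈ slicePoint I ⁻¹' Ω, dbarSlice I f z = 0

/-- The real vector space underlying `ℍ_ℂ = ℍ + ı ℍ`; the pair `(x, y)` stands for `x + ı y`.
(The componentwise product of pairs is not the product of `ℍ_ℂ` and is never used.) -/
abbrev HC : Type := ℍ[ℝ] × ℍ[ℝ]

/-- Complex conjugation of `ℍ_ℂ`: `x + ı y ↦ x - ı y`. -/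
def conjHC (w : HC) : HC := (w.1, -w.2)

/-- Multiplication by `ı` in `ℍ_ℂ`: `x + ı y ↦ -y + ı x`. -/
def iotaMul (w : HC) : HC := (-w.2, w.1)

/-- Holomorphic stem functions on a conjugation-invariant open set `D`: `F(z̄)` is the conjugate of
`F(z)`, and `F` is a holomorphic map from `(D, ı)` to `(ℍ_ℂ, ı)`. -/
structure IsHolomorphicStem (D : Set ℂ) (F : ℂ → HC) : Prop where
  isOpen : IsOpen D
  conj_mem : ∀ z ∈ D, (starRingEnd ℂ) z ∈ D
  stem : ∀ z ∈ D, F ((starRingEnd ℂ) z) = conjHC (F z)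
  contDiffOn : ContDiffOn ℝ 1 F D
  dbar_eq_zero : ∀ z ∈ D, fderiv ℝ F z 1 + iotaMul (fderiv ℝ F z Complex.I) = 0

/-- `φ_J⁻¹(Ω_J^≥)`. -/
def halfDom (Ω : Set ℍ[ℝ]) (J : imagUnits) : Set ℂ := slicePoint J ⁻¹' halfSlice Ω J

/-- `D^J`: the union of `φ_J⁻¹(Ω_J^≥)` and its conjugate. -/
def stemDom (Ω : Set ℍ[ℝ]) (J : imagUnits) : Set ℂ :=
  halfDom Ω J ∪ (starRingEnd ℂ) '' halfDom Ω J

/-- `E^{J,K} = φ_J⁻¹(Ω_J^≥) ∩ φ_K⁻¹(Ω_K^≥)`. -/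
def halfDom₂ (Ω : Set ℍ[ℝ]) (J K : imagUnits) : Set ℂ := halfDom Ω J ∩ halfDom Ω K

/-- `D^{J,K}`: the union of `E^{J,K}` and its conjugate. -/
def stemDom₂ (Ω : Set ℍ[ℝ]) (J K : imagUnits) : Set ℂ :=
  halfDom₂ Ω J K ∪ (starRingEnd ℂ) '' halfDom₂ Ω J K

/-- `(J - K)⁻¹ [J f(α + β J) - K f(α + β K)]`, for `z = α + ı β`. -/
def repValue (f : ℍ[ℝ] → ℍ[ℝ]) (J K : imagUnits) (z : ℂ) : ℍ[ℝ] :=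
  ((J : ℍ[ℝ]) - K)⁻¹ * ((J : ℍ[ℝ]) * f (slicePoint J z) - (K : ℍ[ℝ]) * f (slicePoint K z))

/-- `(J - K)⁻¹ [f(α + β J) - f(α + β K)]`, for `z = α + ı β`. -/
def repDeriv (f : ℍ[ℝ] → ℍ[ℝ]) (J K : imagUnits) (z : ℂ) : ℍ[ℝ] :=
  ((J : ℍ[ℝ]) - K)⁻¹ * (f (slicePoint J z) - f (slicePoint K z))

open Classical in
/-- The double-index stem function `F^{J,K}` (meaningful for `J ≠ K` and on `D^{J,K}`): it is given
by the explicit formula on `E^{J,K}` and by `F(z̄) = conj F(z)` on the conjugate of `E^{J,K}`. -/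
def stem₂ (f : ℍ[ℝ] → ℍ[ℝ]) (J K : imagUnits) (z : ℂ) : HC :=
  if 0 ≤ z.im then (repValue f J K z, repDeriv f J K z)
  else conjHC (repValue f J K ((starRingEnd ℂ) z), repDeriv f J K ((starRingEnd ℂ) z))

/-- The member `F^J` of the holomorphic stem family associated to `f` (meaningful on `D^J`):
`F^J(z)` is the limit of `F^{J,K}(z)` as `K → J` in `𝕊 \ {J}`. -/
def stem (f : ℍ[ℝ] → ℍ[ℝ]) (J : imagUnits) (z : ℂ) : HC :=
  Filter.limUnder (𝓝[≠] J) (fun K : imagUnits => stem₂ f J K z)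

/-- The property that characterizes the holomorphic stem family `{F^J : D^J → ℍ_ℂ}` associated
to `f`: each `F^J` is a holomorphic stem function on `D^J` that, near each point `z` of `D^J`,
coincides with all double-index stem functions `F^{J',K'}` having `J', K'` distinct and close
to `J`. -/
structure IsHolomorphicStemFamily (Ω : Set ℍ[ℝ]) (f : ℍ[ℝ] → ℍ[ℝ])
    (F : imagUnits → ℂ → HC) : Prop where
  holomorphicStem : ∀ J, IsHolomorphicStem (stemDom Ω J) (F J)
  local_eq : ∀ J, ∀ z ∈ stemDom Ω J, ∃ ε : ℝ, 0 < ε ∧ ∃ U : Set ℂ,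
    IsSpearedOpenC U ∧ z ∈ U ∧ U ⊆ stemDom Ω J ∧ coreC Ω ⊆ U ∧
    (U \ coreC Ω ⊆ {w | 0 < w.im} ∨ U \ coreC Ω ⊆ {w | w.im < 0}) ∧
    ∀ J' K' : imagUnits, J' ≠ K' → dist J' J < ε → dist K' J < ε →
      U ⊆ stemDom₂ Ω J' K' ∧ Set.EqOn (stem₂ f J' K') (F J) U
  core_eq : ∀ J J' K' : imagUnits, J' ≠ K' → Set.EqOn (stem₂ f J' K') (F J) (coreC Ω)

/-- A set `Λ` as in the semi-global representation formula at `J₀`: a speared open subset of `Ω`,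
including both `core Ω` and `Ω_{J₀}^≥`, on which the representation formula holds. -/
structure IsRepresentationSet (Ω : Set ℍ[ℝ]) (f : ℍ[ℝ] → ℍ[ℝ]) (J₀ : imagUnits)
    (Λ : Set ℍ[ℝ]) : Prop where
  speared : IsSpearedOpen Λ
  subset : Λ ⊆ Ω
  core_subset : core Ω ⊆ Λ
  halfSlice_subset : halfSlice Ω J₀ ⊆ Λ
  formula : ∀ (I J K : imagUnits) (z : ℂ), J ≠ K → 0 ≤ z.im →
    slicePoint I z ∈ Λ → slicePoint J z ∈ Λ → slicePoint K z ∈ Λ →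
      f (slicePoint I z) = repValue f J K z + (I : ℍ[ℝ]) * repDeriv f J K z

/-- `v` is the spherical value of `f` at `x = α + β J₀ ∈ Ω` (`β ≥ 0`):
`v = (J - K)⁻¹ [J f(α + β J) - K f(α + β K)]` whenever `J ≠ K` and
`α + β J, α + β K` belong to a set `Λ` as above. -/
def IsSphericalValue (Ω : Set ℍ[ℝ]) (f : ℍ[ℝ] → ℍ[ℝ]) (x v : ℍ[ℝ]) : Prop :=
  x ∈ Ω ∧ ∃ (J₀ : imagUnits) (z : ℂ) (Λ : Set ℍ[ℝ]),
    0 ≤ z.im ∧ x = slicePoint J₀ z ∧ IsRepresentationSet Ω f J₀ Λ ∧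
    ∀ J K : imagUnits, J ≠ K → slicePoint J z ∈ Λ → slicePoint K z ∈ Λ → v = repValue f J K z

/-- `v` is the spherical derivative of `f` at `x = α + β J₀ ∈ Ω` (`β > 0`):
`v = β⁻¹ (J - K)⁻¹ [f(α + β J) - f(α + β K)]` whenever `J ≠ K` and
`α + β J, α + β K` belong to a set `Λ` as above. -/
def IsSphericalDerivative (Ω : Set ℍ[ℝ]) (f : ℍ[ℝ] → ℍ[ℝ]) (x v : ℍ[ℝ]) : Prop :=
  x ∈ Ω ∧ ∃ (J₀ : imagUnits) (z : ℂ) (Λ : Set ℍ[ℝ]),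
    0 < z.im ∧ x = slicePoint J₀ z ∧ IsRepresentationSet Ω f J₀ Λ ∧
    ∀ J K : imagUnits, J ≠ K → slicePoint J z ∈ Λ → slicePoint K z ∈ Λ →
      v = (z.im)⁻¹ • repDeriv f J K z

/-- The spherical value `f°_s(x)` (meaningful for `x ∈ Ω`). -/
def sphericalValue (Ω : Set ℍ[ℝ]) (f : ℍ[ℝ] → ℍ[ℝ]) (x : ℍ[ℝ]) : ℍ[ℝ] :=
  Classical.epsilon (IsSphericalValue Ω f x)

/-- The spherical derivative `f'_s(x)` (meaningful for `x ∈ Ω \ ℝ`). -/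
def sphericalDerivative (Ω : Set ℍ[ℝ]) (f : ℍ[ℝ] → ℍ[ℝ]) (x : ℍ[ℝ]) : ℍ[ℝ] :=
  Classical.epsilon (IsSphericalDerivative Ω f x)

/-- `Shadows Ω x₁ y₁ x₀ y₀`: the pair `(x₁, y₁)` shadows `(x₀, y₀)` in `Ω`, i.e.,
`x₀ = α + β J₀`, `x₁ = α + β J₁`, `y₀ = α' + β' J₀`, `y₁ = α' + β' J₁` (with `β, β' ≥ 0`) all
belong to `Ω` and there is a path in `E^{J₀,J₁}` from `α + β ı` to `α' + β' ı`. -/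
def Shadows (Ω : Set ℍ[ℝ]) (x₁ y₁ x₀ y₀ : ℍ[ℝ]) : Prop :=
  ∃ (J₀ J₁ : imagUnits) (z w : ℂ), 0 ≤ z.im ∧ 0 ≤ w.im ∧
    x₀ = slicePoint J₀ z ∧ x₁ = slicePoint J₁ z ∧ y₀ = slicePoint J₀ w ∧ y₁ = slicePoint J₁ w ∧
    x₀ ∈ Ω ∧ x₁ ∈ Ω ∧ y₀ ∈ Ω ∧ y₁ ∈ Ω ∧ JoinedIn (halfDom₂ Ω J₀ J₁) z w

/-- `x₁` is strongly hinged to `x₀` in `Ω`. -/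
def StronglyHinged (Ω : Set ℍ[ℝ]) (x₁ x₀ : ℍ[ℝ]) : Prop :=
  ∃ a : ℝ, (a : ℍ[ℝ]) ∈ Ω ∧ Shadows Ω x₁ a x₀ a

/-- Conditions 1 and 2 for a step between `p = x_s` and `q = x_{s'}`: `q` belongs to the connected
component of `𝕊_p ∩ Ω` that includes `p`, or `q` is strongly hinged to `p`. -/
def SimpleCondition (Ω : Set ℍ[ℝ]) (p q : ℍ[ℝ]) : Prop :=
  q ∈ connectedComponentIn (sphereThrough p ∩ Ω) p ∨ StronglyHinged Ω q p

/-- For the finite sequence `x 0, …, x t`, there is a simple step at `s₀`. -/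
def SimpleStep (Ω : Set ℍ[ℝ]) (t : ℕ) (x : ℕ → ℍ[ℝ]) (s₀ : ℕ) : Prop :=
  ∃ s s' : ℕ, s ≤ t ∧ s' ≤ t ∧ (s' = s + 1 ∨ s = s' + 1) ∧ s₀ = min s s' ∧
    SimpleCondition Ω (x s) (x s')

/-- For the finite sequence `x 0, …, x t`, there is a double step at `(lo, hi)`.
(The indices `r, r'` form the second pair, which shadows the first pair `s, s'`.) -/
def DoubleStep (Ω : Set ℍ[ℝ]) (t : ℕ) (x : ℕ → ℍ[ℝ]) (lo hi : ℕ) : Prop :=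
  ∃ s s' r r' : ℕ, s ≤ t ∧ s' ≤ t ∧ r ≤ t ∧ r' ≤ t ∧ (s' = s + 1 ∨ s = s' + 1) ∧
    ¬ SimpleCondition Ω (x s) (x s') ∧
    r ≠ s ∧ r ≠ s' ∧ r' ≠ s ∧ r' ≠ s' ∧ (r : ℤ) - (r' : ℤ) = (s' : ℤ) - (s : ℤ) ∧
    Shadows Ω (x r) (x r') (x s) (x s') ∧
    lo = min (min s s') (min r r') ∧ hi = max (max s s') (max r r') - 1

/-- `x 0, …, x t` is a chain of length `t ≥ 1` in `Ω`: the indices `s < t` at which no simple step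
happens can be listed, without repetitions, as `lo 0, hi 0, …, lo (ℓ - 1), hi (ℓ - 1)`, where a
double step happens at each `(lo m, hi m)`, the double steps are listed in the order in which they
start, and no two of them are intertwined. -/
structure IsHingeChain (Ω : Set ℍ[ℝ]) (t : ℕ) (x : ℕ → ℍ[ℝ]) : Prop where
  one_le : 1 ≤ t
  mem : ∀ s ≤ t, x s ∈ Ω
  pairing : ∃ (ℓ : ℕ) (lo hi : Fin ℓ → ℕ),
    Function.Injective (Sum.elim lo hi) ∧
    Set.range (Sum.elim lo hi) = {s | s < t ∧ ¬ SimpleStep Ω t x s} ∧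
    (∀ m, DoubleStep Ω t x (lo m) (hi m)) ∧
    StrictMono lo ∧
    ∀ m n, m < n → hi m < lo n ∨ hi n < hi m

/-- `x ∼ x'`: there is a chain in `Ω` connecting `x` and `x'`. -/
def Hinged (Ω : Set ℍ[ℝ]) (x x' : ℍ[ℝ]) : Prop :=
  ∃ (t : ℕ) (c : ℕ → ℍ[ℝ]), IsHingeChain Ω t c ∧ c 0 = x ∧ c t = x'

end

/-!
The formula `F^{J,K} = V^{J,K} + ı W^{J,K}` makes sense on both half-planes (`repStem`), and slice
regularity of `f` says precisely that `V` and `W` satisfy the Cauchy–Riemann equations, so that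
`F^{J,K}` is holomorphic wherever it is defined (`holomorphicWrt_repStem`). At a real point it takes
the value `f`, whatever `J` and `K` are. Hence, by the identity principle, all the `F^{J,K}` that are
defined on a speared open set coincide there (`repStem_eq_repStem`), and the representation formula
holds over that set (`representation_formula`). On the core this involves all units; in particular
`F^{J,K}` and its conjugate `F^{-J,-K}` agree there, so that the reflected function `stem₂` is
holomorphic across the real axis.

Off the core, the point is that every `z` in `φ_J⁻¹(Ω_J^≥)` has a speared neighbourhood, exceeding
the core only above the real axis, which is mapped into `Ω` by `φ_I` for all `I` close to `J`
(`exists_isAdapted`). Such a neighbourhood is grown from the real axis by adding half-balls along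
the connected set which, `Ω` being speared, joins `z` to the real axis. On it, all `F^{J',K'}` with
`J', K'` close to `J` coincide. Therefore the limit that defines `F^J` is eventually constant, and
`F^J` is holomorphic and locally constant in `J`. Gluing these neighbourhoods yields a set `Λ` over
which the representation formula holds (`adaptedSet`); any two choices of `Λ` share nearby points of
the same sphere, whence the uniqueness of spherical values and derivatives, which are then the
components of `F^J`.

For hinged points, consider the relation `SameGerm`: `x = α + β J` and `y = α + β K` are related when
`F^J` and `F^K` have the same germ at `α + ı β`. It is an equivalence relation on `Ω`. Simple steps
link related points, because `F^J` is locally constant in `J` and all the `F^J` agree at real points.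
When one pair of points shadows another, the identity principle along the path in `E^{J,K}` propagates
equality of germs from one end to the other; thus a double step at `(lo, hi)` carries the relation
from the pair `lo + 1, hi` to the pair `lo, hi + 1`. The double steps of a chain are nested like
brackets, and an induction on the length of balanced intervals (`rel_of_nested_brackets`) shows that
the ends of the chain are related.
-/

noncomputable section


/-! ### Imaginary units and slices -/

lemma re_eq_zero_of_imagUnits (J : imagUnits) : (J : ℍ[ℝ]).re = 0 := by
  obtain ⟨J, hJ⟩ := J
  have h : J ^ 2 = -1 := hJ
  rw [sq] at h
  have h0 := congrArg QuaternionAlgebra.re h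
  have h1 := congrArg QuaternionAlgebra.imI h
  have h2 := congrArg QuaternionAlgebra.imJ h
  have h3 := congrArg QuaternionAlgebra.imK h
  simp at h0 h1 h2 h3
  by_contra hne
  have e1 : J.imI = 0 := mul_left_cancel₀ hne (by linarith)
  have e2 : J.imJ = 0 := mul_left_cancel₀ hne (by linarith)
  have e3 : J.imK = 0 := mul_left_cancel₀ hne (by linarith)
  rw [e1, e2, e3] at h0
  nlinarith [sq_nonneg J.re]

lemma mul_self_imagUnits (J : imagUnits) : (J : ℍ[ℝ]) * J = -1 := by
  rw [← sq]; exact J.2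

lemma norm_imagUnits (J : imagUnits) : ‖(J : ℍ[ℝ])‖ = 1 := by
  have h := congrArg norm (mul_self_imagUnits J)
  rw [norm_mul, norm_neg, norm_one] at h
  nlinarith [norm_nonneg (J : ℍ[ℝ])]

instance : Neg imagUnits := ⟨fun J => ⟨-J, by simpa [imagUnits] using J.2⟩⟩

@[simp] lemma coe_neg_imagUnits (J : imagUnits) : ((-J : imagUnits) : ℍ[ℝ]) = -J := rfl

lemma neg_injective_imagUnits {J K : imagUnits} (h : J ≠ K) : -J ≠ -K := fun e =>
  h (Subtype.ext (neg_injective (congrArg Subtype.val e)))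

/-- No imaginary unit is isolated in `𝕊`: it is the limit, as `t → 0`, of its conjugates by
`1 + t q`, where `q` is any quaternion that does not commute with it. -/
instance nhdsNE_neBot_imagUnits (J : imagUnits) : (𝓝[≠] J).NeBot := by
  obtain ⟨q, hq⟩ : ∃ q : ℍ[ℝ], q * J ≠ J * q := by
    by_contra! h
    have hJ : ∀ q : ℍ[ℝ], (q * J).imJ = (J * q).imJ := fun q => by rw [h q]
    have hK : ∀ q : ℍ[ℝ], (q * J).imK = (J * q).imK := fun q => by rw [h q]
    simp only [Quaternion.imJ_mul, Quaternion.imK_mul] at hJ hK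
    have hr := re_eq_zero_of_imagUnits J
    have a1 := hJ ⟨0, 1, 0, 0⟩
    have a2 := hK ⟨0, 1, 0, 0⟩
    have a3 := hK ⟨0, 0, 1, 0⟩
    simp only [zero_mul, mul_zero, one_mul, mul_one] at a1 a2 a3
    have : (J : ℍ[ℝ]) = 0 := by ext <;> simp <;> linarith
    simpa [this] using norm_imagUnits J
  let u : ℝ → ℍ[ℝ] := fun t => 1 + t • q
  have hu : Continuous u := by fun_prop
  have hu0 : u 0 = 1 := by simp [u]
  have hne : ∀ᶠ t in 𝓝 (0 : ℝ), u t ≠ 0 :=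
    hu.continuousAt.eventually_ne (by rw [hu0]; exact one_ne_zero)
  have hlim : Filter.Tendsto (fun t => u t * J * (u t)⁻¹) (𝓝 0) (𝓝 (J : ℍ[ℝ])) := by
    have h1 : ContinuousAt (fun t => u t * J * (u t)⁻¹) 0 :=
      (hu.continuousAt.mul continuousAt_const).mul
        (hu.continuousAt.inv₀ (by rw [hu0]; exact one_ne_zero))
    simpa [ContinuousAt, hu0] using h1
  rw [← mem_closure_iff_nhdsWithin_neBot, mem_closure_iff_nhds]
  intro V hV
  obtain ⟨W, hW, hWV⟩ := mem_nhds_subtype _ _ _ |>.1 hV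
  have hev := (hlim.eventually hW).and hne
  obtain ⟨t, ⟨htW, htu⟩, ht0⟩ :=
    ((hev.filter_mono nhdsWithin_le_nhds).and (self_mem_nhdsWithin : _ ∈ 𝓝[≠] (0 : ℝ))).exists
  have hmem : u t * J * (u t)⁻¹ ∈ imagUnits := by
    change _ ^ 2 = _
    rw [sq]
    calc u t * J * (u t)⁻¹ * (u t * J * (u t)⁻¹)
        = u t * J * ((u t)⁻¹ * u t) * J * (u t)⁻¹ := by simp only [mul_assoc]
      _ = u t * (J * J) * (u t)⁻¹ := by rw [inv_mul_cancel₀ htu]; simp only [mul_assoc, mul_one]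
      _ = -1 := by rw [mul_self_imagUnits]; simp [htu]
  refine ⟨⟨_, hmem⟩, hWV htW, fun hJ => hq ?_⟩
  have hJ' : u t * J * (u t)⁻¹ = J := congrArg Subtype.val hJ
  have h2 : u t * J = J * u t := by
    conv_rhs => rw [← hJ', mul_assoc, inv_mul_cancel₀ htu, mul_one]
  simp only [u, add_mul, mul_add, one_mul, mul_one, smul_mul_assoc, mul_smul_comm,
    add_right_inj] at h2
  exact smul_right_injective _ ht0 h2

lemma slicePoint_re (J : imagUnits) (z : ℂ) : (slicePoint J z).re = z.re := by
  simp [slicePoint, re_eq_zero_of_imagUnits]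

lemma slicePoint_im (J : imagUnits) (z : ℂ) : (slicePoint J z).im = z.im • (J : ℍ[ℝ]) := by
  have h := re_eq_zero_of_imagUnits J
  ext <;> simp [slicePoint, h]

lemma slicePoint_conj (J : imagUnits) (z : ℂ) :
    slicePoint J ((starRingEnd ℂ) z) = slicePoint (-J) z := by
  simp [slicePoint]

lemma slicePoint_neg_conj (J : imagUnits) (z : ℂ) :
    slicePoint (-J) ((starRingEnd ℂ) z) = slicePoint J z := by
  simp [slicePoint]

lemma slicePoint_of_im_eq_zero (J : imagUnits) {z : ℂ} (hz : z.im = 0) :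
    slicePoint J z = (z.re : ℍ[ℝ]) := by
  simp [slicePoint, hz]

@[simp] lemma slicePoint_ofReal (J : imagUnits) (a : ℝ) :
    slicePoint J (a : ℂ) = (a : ℍ[ℝ]) := by
  simp [slicePoint]

lemma continuous_slicePoint₂ : Continuous (fun p : imagUnits × ℂ => slicePoint p.1 p.2) := by
  unfold slicePoint
  have := Quaternion.continuous_coe
  fun_prop

lemma continuous_slicePoint (J : imagUnits) : Continuous (slicePoint J) :=
  continuous_slicePoint₂.comp (Continuous.prodMk_right J)

lemma norm_slicePoint_sub_coe (J : imagUnits) (z : ℂ) (a : ℝ) :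
    ‖slicePoint J z - (a : ℍ[ℝ])‖ = ‖z - a‖ := by
  have h1 : ∀ q : ℍ[ℝ], ‖q‖ ^ 2 = q.re ^ 2 + ‖q.im‖ ^ 2 := fun q => by
    simp only [sq ‖_‖, ← Quaternion.normSq_eq_norm_mul_self, Quaternion.normSq_def',
      Quaternion.re_im, Quaternion.imI_im, Quaternion.imJ_im, Quaternion.imK_im]
    ring
  rw [← sq_eq_sq₀ (norm_nonneg _) (norm_nonneg _), h1, ← Complex.normSq_eq_norm_sq,
    Complex.normSq_apply]
  have h2 : (slicePoint J z - (a : ℍ[ℝ])).im = z.im • (J : ℍ[ℝ]) := by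
    rw [← slicePoint_im]; ext <;> simp
  rw [h2, norm_smul, norm_imagUnits]
  simp [slicePoint_re]
  ring

/-- The real part of a quaternion and the norm of its imaginary part, as a point of the closed
upper half-plane: the common left inverse of all the maps `φ_J` on that half-plane. -/
def foldHalf (q : ℍ[ℝ]) : ℂ := ⟨q.re, ‖q.im‖⟩

lemma continuous_foldHalf : Continuous foldHalf := by
  have : foldHalf = fun q => (q.re : ℂ) + (‖q.im‖ : ℝ) * Complex.I := by
    ext q; apply Complex.ext <;> simp [foldHalf]
  rw [this]
  have h1 := Quaternion.continuous_re
  have h2 := Quaternion.continuous_im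
  fun_prop

lemma foldHalf_slicePoint (J : imagUnits) {z : ℂ} (hz : 0 ≤ z.im) :
    foldHalf (slicePoint J z) = z := by
  apply Complex.ext
  · exact slicePoint_re J z
  · simp [foldHalf, slicePoint_im, norm_smul, norm_imagUnits, abs_of_nonneg hz]

/-- A nonreal quaternion determines its representation `α + β J` with `β > 0`. -/
lemma slicePoint_inj {J K : imagUnits} {z w : ℂ} (hz : 0 ≤ z.im) (hw : 0 ≤ w.im)
    (h : slicePoint J z = slicePoint K w) : z = w ∧ (z.im = 0 ∨ J = K) := by
  have hzw : z = w := by rw [← foldHalf_slicePoint J hz, h, foldHalf_slicePoint K hw]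
  refine ⟨hzw, or_iff_not_imp_left.2 fun h0 => ?_⟩
  have := congrArg Quaternion.im h
  rw [slicePoint_im, slicePoint_im, ← hzw] at this
  exact Subtype.ext (smul_right_injective _ h0 this)

/-- Every nonreal quaternion has the form `α + β J`. -/
lemma exists_slicePoint_of_im_ne_zero {q : ℍ[ℝ]} (hq : q.im ≠ 0) :
    ∃ J : imagUnits, (J : ℍ[ℝ]) = ‖q.im‖⁻¹ • q.im ∧ q = slicePoint J (foldHalf q) := by
  have hn : ‖q.im‖ ≠ 0 := norm_ne_zero_iff.2 hq
  have hmem : ‖q.im‖⁻¹ • q.im ∈ imagUnits := by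
    change _ ^ 2 = _
    have h1 : q.im * q.im = ((-(‖q.im‖ * ‖q.im‖) : ℝ) : ℍ[ℝ]) := by
      rw [← Quaternion.normSq_eq_norm_mul_self, Quaternion.normSq_def', ← sq]
      ext <;> simp [sq, -Quaternion.coe_mul] <;> ring
    rw [sq, smul_mul_smul_comm, h1, ← Quaternion.coe_smul]
    have : (‖q.im‖⁻¹ * ‖q.im‖⁻¹) • (-(‖q.im‖ * ‖q.im‖)) = -1 := by
      rw [smul_eq_mul]; field_simp
    rw [this]; simp
  refine ⟨⟨_, hmem⟩, rfl, ?_⟩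
  simp only [slicePoint, foldHalf, smul_smul, mul_inv_cancel₀ hn, one_smul]
  exact (Quaternion.re_add_im q).symm

lemma exists_slicePoint (q : ℍ[ℝ]) (J₀ : imagUnits) :
    ∃ J : imagUnits, q = slicePoint J (foldHalf q) := by
  by_cases hq : q.im = 0
  · refine ⟨J₀, ?_⟩
    rw [slicePoint_of_im_eq_zero _ (by simp [foldHalf, hq])]
    conv_lhs => rw [← Quaternion.re_add_im q, hq, add_zero]
    rfl
  · obtain ⟨J, -, hJ⟩ := exists_slicePoint_of_im_ne_zero hq
    exact ⟨J, hJ⟩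

lemma mem_halfDom {Ω : Set ℍ[ℝ]} {J : imagUnits} {z : ℂ} :
    z ∈ halfDom Ω J ↔ slicePoint J z ∈ Ω ∧ 0 ≤ z.im := by
  constructor
  · rintro ⟨h1, w, hw, h2⟩
    refine ⟨h1, ?_⟩
    by_contra! hz
    have h3 : slicePoint (-J) ((starRingEnd ℂ) z) = slicePoint J w := by
      rw [slicePoint_neg_conj, h2]
    obtain ⟨h4, h5⟩ := slicePoint_inj (by simpa using hz.le) hw h3
    rcases h5 with h5 | h5
    · simp at h5; exact hz.ne h5
    · have h6 : (-J : ℍ[ℝ]) = J := congrArg Subtype.val h5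
      have h7 : (J : ℍ[ℝ]) = 0 := by
        have h8 : (2 : ℝ) • (J : ℍ[ℝ]) = 0 := by rw [two_smul]; nth_rewrite 1 [← h6]; simp
        simpa using h8
      simpa [h7] using norm_imagUnits J
  · rintro ⟨h1, h2⟩
    exact ⟨h1, z, h2, rfl⟩

lemma halfDom_subset_stemDom (Ω : Set ℍ[ℝ]) (J : imagUnits) : halfDom Ω J ⊆ stemDom Ω J :=
  Set.subset_union_left

lemma conj_mem_stemDom {Ω : Set ℍ[ℝ]} {J : imagUnits} {z : ℂ} (hz : z ∈ stemDom Ω J) :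
    (starRingEnd ℂ) z ∈ stemDom Ω J := by
  rcases hz with hz | ⟨w, hw, rfl⟩
  · exact Or.inr ⟨z, hz, rfl⟩
  · rw [Complex.conj_conj]; exact Or.inl hw

lemma mem_halfDom_of_mem_stemDom {Ω : Set ℍ[ℝ]} {J : imagUnits} {z : ℂ}
    (hz : z ∈ stemDom Ω J) (him : 0 ≤ z.im) : z ∈ halfDom Ω J := by
  rcases hz with hz | ⟨w, hw, rfl⟩
  · exact hz
  · have hw' := (mem_halfDom.1 hw).2
    have : (starRingEnd ℂ) w = w := Complex.conj_eq_iff_im.2 (by simp at him; linarith)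
    rwa [this]

lemma stemDom₂_eq (Ω : Set ℍ[ℝ]) (J K : imagUnits) :
    stemDom₂ Ω J K = stemDom Ω J ∩ stemDom Ω K := by
  ext z
  constructor
  · rintro (⟨h1, h2⟩ | ⟨w, ⟨h1, h2⟩, rfl⟩)
    · exact ⟨Or.inl h1, Or.inl h2⟩
    · exact ⟨Or.inr ⟨w, h1, rfl⟩, Or.inr ⟨w, h2, rfl⟩⟩
  · rintro ⟨h1, h2⟩
    rcases le_total 0 z.im with h | h
    · exact Or.inl ⟨mem_halfDom_of_mem_stemDom h1 h, mem_halfDom_of_mem_stemDom h2 h⟩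
    · have h' : 0 ≤ ((starRingEnd ℂ) z).im := by simpa using h
      exact Or.inr ⟨(starRingEnd ℂ) z,
        ⟨mem_halfDom_of_mem_stemDom (conj_mem_stemDom h1) h',
          mem_halfDom_of_mem_stemDom (conj_mem_stemDom h2) h'⟩, Complex.conj_conj z⟩

/-! ### Holomorphy with respect to a complex structure -/

/-- `g` is `C¹` on `U` and `∂g/∂α + T ∂g/∂β = 0` there. When `T² = -1`, this is holomorphy with
respect to the complex structure `T` of the target; here `T` will be either multiplication by `ı` on
`ℍ_ℂ` or left multiplication by an imaginary unit on `ℍ`. -/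
structure HolomorphicWrt {E : Type*} [NormedAddCommGroup E] [NormedSpace ℝ E] (T : E →L[ℝ] E)
    (g : ℂ → E) (U : Set ℂ) : Prop where
  contDiffOn : ContDiffOn ℝ 1 g U
  dbar : ∀ z ∈ U, fderiv ℝ g z 1 + T (fderiv ℝ g z Complex.I) = 0

namespace HolomorphicWrt

variable {E : Type*} [NormedAddCommGroup E] [NormedSpace ℝ E] {T : E →L[ℝ] E} {g h : ℂ → E}
  {U V : Set ℂ}

lemma differentiableAt (hU : IsOpen U) (hg : HolomorphicWrt T g U) {z : ℂ} (hz : z ∈ U) :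
    DifferentiableAt ℝ g z :=
  (hg.contDiffOn.contDiffAt (hU.mem_nhds hz)).differentiableAt one_ne_zero

lemma mono (hg : HolomorphicWrt T g U) (hVU : V ⊆ U) : HolomorphicWrt T g V :=
  ⟨hg.contDiffOn.mono hVU, fun z hz => hg.dbar z (hVU hz)⟩

lemma sub (hU : IsOpen U) (hg : HolomorphicWrt T g U) (hh : HolomorphicWrt T h U) :
    HolomorphicWrt T (fun z => g z - h z) U := by
  refine ⟨hg.contDiffOn.sub hh.contDiffOn, fun z hz => ?_⟩
  have h1 := hg.dbar z hz
  have h2 := hh.dbar z hz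
  rw [fderiv_fun_sub (hg.differentiableAt hU hz) (hh.differentiableAt hU hz)]
  simp only [sub_apply, map_sub]
  rw [← sub_zero (0 : E)]
  nth_rewrite 1 [← h1]
  rw [← h2]
  abel

lemma congr (hU : IsOpen U) (hg : HolomorphicWrt T g U) (hgh : Set.EqOn h g U) :
    HolomorphicWrt T h U := by
  refine ⟨hg.contDiffOn.congr hgh, fun z hz => ?_⟩
  rw [(hgh.eventuallyEq_of_mem (hU.mem_nhds hz)).fderiv_eq]
  exact hg.dbar z hz

/-- Composing with `x ↦ ℓ x - i ℓ (T x)`, for all continuous linear functionals `ℓ`, reduces the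
identity principle to the one for complex-valued holomorphic functions. -/
theorem eqOn_zero (hT : ∀ x, T (T x) = -x) (hU : IsOpen U) (hc : IsPreconnected U)
    (hg : HolomorphicWrt T g U) {z₀ : ℂ} (hz₀ : z₀ ∈ U) (h0 : ∃ᶠ z in 𝓝[≠] z₀, g z = 0) :
    ∀ z ∈ U, g z = 0 := by
  intro z hz
  refine SeparatingDual.eq_zero_of_forall_dual_eq_zero (R := ℝ) fun ℓ => ?_
  let L : E →L[ℝ] ℂ := Complex.ofRealCLM.comp ℓ - Complex.I • Complex.ofRealCLM.comp (ℓ.comp T)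
  have hL : ∀ x, L x = (ℓ x : ℂ) - Complex.I * (ℓ (T x) : ℂ) := fun x => by simp [L]
  have hdiff : DifferentiableOn ℂ (fun w => L (g w)) U := by
    intro w hw
    have hgw := hg.differentiableAt hU hw
    refine DifferentiableAt.differentiableWithinAt ?_
    rw [differentiableAt_complex_iff_differentiableAt_real]
    refine ⟨L.differentiableAt.comp w hgw, ?_⟩
    have hf : fderiv ℝ (fun w => L (g w)) w = L.comp (fderiv ℝ g w) :=
      (L.hasFDerivAt.comp w hgw.hasFDerivAt).fderiv
    have h1 : fderiv ℝ g w 1 = -T (fderiv ℝ g w Complex.I) :=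
      eq_neg_of_add_eq_zero_left (hg.dbar w hw)
    rw [hf, ContinuousLinearMap.comp_apply, ContinuousLinearMap.comp_apply, h1, hL, hL]
    simp only [map_neg, hT, smul_eq_mul, Complex.ofReal_neg]
    linear_combination (ℓ (fderiv ℝ g w Complex.I) : ℂ) * Complex.I_mul_I
  have hz' : L (g z) = 0 :=
    (hdiff.analyticOnNhd hU).eqOn_zero_of_preconnected_of_frequently_eq_zero hc hz₀
      (h0.mono fun w hw => by simp [hw]) hz
  have := congrArg Complex.re ((hL _).symm.trans hz')
  simpa using this

/-- A function that vanishes at the real points of a speared open set, and is holomorphic there,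
vanishes identically. -/
theorem eqOn_zero_of_speared (hT : ∀ x, T (T x) = -x) (hU : IsSpearedOpenC U)
    (hg : HolomorphicWrt T g U) (h0 : ∀ a : ℝ, (a : ℂ) ∈ U → g a = 0) : ∀ z ∈ U, g z = 0 := by
  intro z hz
  obtain ⟨a, ha⟩ := hU.2 z hz
  have hsub := connectedComponentIn_subset U z
  refine eqOn_zero hT hU.1.connectedComponentIn isPreconnected_connectedComponentIn
    (hg.mono hsub) ha ?_ z (mem_connectedComponentIn hz)
  have hev : ∀ᶠ b : ℝ in 𝓝[≠] a, g (b : ℂ) = 0 := by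
    have h1 : ∀ᶠ b : ℝ in 𝓝 a, (b : ℂ) ∈ U :=
      Complex.continuous_ofReal.continuousAt.eventually (hU.1.mem_nhds (hsub ha))
    exact (h1.mono h0).filter_mono nhdsWithin_le_nhds
  have ht : Filter.Tendsto (fun b : ℝ => (b : ℂ)) (𝓝[≠] a) (𝓝[≠] (a : ℂ)) :=
    Complex.continuous_ofReal.continuousAt.continuousWithinAt.tendsto_nhdsWithin
      fun b hb => by simpa using hb
  exact ht.frequently hev.frequently

end HolomorphicWrt


/-! ### The double-index stem functions -/

/-- Multiplication by `ı` on `ℍ_ℂ`, as a continuous linear map. -/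
def iotaCLM : HC →L[ℝ] HC :=
  (-ContinuousLinearMap.snd ℝ ℍ[ℝ] ℍ[ℝ]).prod (ContinuousLinearMap.fst ℝ ℍ[ℝ] ℍ[ℝ])

lemma iotaCLM_apply (w : HC) : iotaCLM w = iotaMul w := rfl

lemma iotaCLM_iotaCLM (w : HC) : iotaCLM (iotaCLM w) = -w := by
  simp only [iotaCLM_apply, iotaMul]; rfl

/-- Left multiplication by the imaginary unit `J`, as a continuous linear map. -/
def unitCLM (J : imagUnits) : ℍ[ℝ] →L[ℝ] ℍ[ℝ] := ContinuousLinearMap.mul ℝ ℍ[ℝ] J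

lemma unitCLM_apply (J : imagUnits) (q : ℍ[ℝ]) : unitCLM J q = J * q := rfl

lemma unitCLM_unitCLM (J : imagUnits) (q : ℍ[ℝ]) : unitCLM J (unitCLM J q) = -q := by
  rw [unitCLM_apply, unitCLM_apply, ← mul_assoc, mul_self_imagUnits, neg_one_mul]

/-- `F^{J,K}` given by the explicit formula on both half-planes: it agrees with `stem₂ f J K` on
the closed upper half-plane, but it is manifestly holomorphic across the real axis. -/
def repStem (f : ℍ[ℝ] → ℍ[ℝ]) (J K : imagUnits) (z : ℂ) : HC :=
  (repValue f J K z, repDeriv f J K z)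

lemma coe_sub_ne_zero {J K : imagUnits} (hJK : J ≠ K) : (J : ℍ[ℝ]) - K ≠ 0 :=
  sub_ne_zero.2 fun h => hJK (Subtype.ext h)

lemma repValue_of_im_eq_zero (f : ℍ[ℝ] → ℍ[ℝ]) {J K : imagUnits} (hJK : J ≠ K) {z : ℂ}
    (hz : z.im = 0) : repValue f J K z = f z.re := by
  rw [repValue, slicePoint_of_im_eq_zero J hz, slicePoint_of_im_eq_zero K hz, ← sub_mul,
    ← mul_assoc, inv_mul_cancel₀ (coe_sub_ne_zero hJK), one_mul]

lemma repDeriv_of_im_eq_zero (f : ℍ[ℝ] → ℍ[ℝ]) (J K : imagUnits) {z : ℂ}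
    (hz : z.im = 0) : repDeriv f J K z = 0 := by
  rw [repDeriv, slicePoint_of_im_eq_zero J hz, slicePoint_of_im_eq_zero K hz, sub_self, mul_zero]

lemma repStem_ofReal (f : ℍ[ℝ] → ℍ[ℝ]) {J K : imagUnits} (hJK : J ≠ K) (a : ℝ) :
    repStem f J K a = (f a, 0) := by
  simp [repStem, repValue_of_im_eq_zero f hJK (Complex.ofReal_im a),
    repDeriv_of_im_eq_zero f J K (Complex.ofReal_im a)]

/-- Conjugation in the source and in the target amounts to changing the signs of the two
imaginary units. -/
lemma conjHC_repStem_conj (f : ℍ[ℝ] → ℍ[ℝ]) (J K : imagUnits) (z : ℂ) :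
    conjHC (repStem f J K ((starRingEnd ℂ) z)) = repStem f (-J) (-K) z := by
  have h : (-(J : ℍ[ℝ]) - -(K : ℍ[ℝ])) = -((J : ℍ[ℝ]) - K) := by abel
  simp only [conjHC, repStem, repValue, repDeriv, slicePoint_conj, coe_neg_imagUnits, h, inv_neg]
  congr 1
  · rw [neg_mul, ← mul_neg]
    congr 1
    rw [neg_mul, neg_mul]
    abel
  · rw [neg_mul]

lemma stem₂_of_nonneg (f : ℍ[ℝ] → ℍ[ℝ]) (J K : imagUnits) {z : ℂ} (hz : 0 ≤ z.im) :
    stem₂ f J K z = repStem f J K z := if_pos hz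

lemma stem₂_of_neg (f : ℍ[ℝ] → ℍ[ℝ]) (J K : imagUnits) {z : ℂ} (hz : z.im < 0) :
    stem₂ f J K z = repStem f (-J) (-K) z := by
  rw [stem₂, if_neg hz.not_ge, ← conjHC_repStem_conj]; rfl

lemma conjHC_conjHC (w : HC) : conjHC (conjHC w) = w := by simp [conjHC]

lemma continuous_conjHC : Continuous conjHC := by unfold conjHC; fun_prop

lemma stem₂_conj (f : ℍ[ℝ] → ℍ[ℝ]) (J K : imagUnits) (z : ℂ) :
    stem₂ f J K ((starRingEnd ℂ) z) = conjHC (stem₂ f J K z) := by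
  rcases lt_trichotomy z.im 0 with h | h | h
  · rw [stem₂_of_neg f J K h, stem₂_of_nonneg f J K (by simpa using h.le), ← conjHC_repStem_conj,
      conjHC_conjHC]
  · rw [Complex.conj_eq_iff_im.2 h, stem₂_of_nonneg f J K h.ge, repStem, conjHC,
      repDeriv_of_im_eq_zero f J K h, neg_zero]
  · rw [stem₂_of_nonneg f J K h.le, stem₂_of_neg f J K (by simpa using h), ← conjHC_repStem_conj,
      Complex.conj_conj]

section Holomorphy

variable {Ω : Set ℍ[ℝ]} {f : ℍ[ℝ] → ℍ[ℝ]}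

lemma IsSliceRegular.holomorphicWrt (hf : IsSliceRegular Ω f) (J : imagUnits) :
    HolomorphicWrt (unitCLM J) (fun w => f (slicePoint J w)) (slicePoint J ⁻¹' Ω) := by
  refine ⟨(hf J).1, fun z hz => ?_⟩
  have h := (hf J).2 z hz
  rw [dbarSlice] at h
  exact (smul_eq_zero.1 h).resolve_left (by norm_num)

lemma isOpen_slicePreimage (hΩ : IsOpen Ω) (J : imagUnits) : IsOpen (slicePoint J ⁻¹' Ω) :=
  hΩ.preimage (continuous_slicePoint J)

/-- `V` and `W` satisfy the Cauchy–Riemann equations `∂V/∂α = ∂W/∂β`, `∂V/∂β = -∂W/∂α`, because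
`∂f_J/∂β = J ∂f_J/∂α` and `∂f_K/∂β = K ∂f_K/∂α`. -/
lemma holomorphicWrt_repStem (hΩ : IsOpen Ω) (hf : IsSliceRegular Ω f) (J K : imagUnits) :
    HolomorphicWrt iotaCLM (repStem f J K) (slicePoint J ⁻¹' Ω ∩ slicePoint K ⁻¹' Ω) := by
  have hJ := hf.holomorphicWrt J
  have hK := hf.holomorphicWrt K
  constructor
  · have h1 := hJ.contDiffOn.mono (Set.inter_subset_left (t := slicePoint K ⁻¹' Ω))
    have h2 := hK.contDiffOn.mono (Set.inter_subset_right (s := slicePoint J ⁻¹' Ω))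
    exact (contDiffOn_const.mul ((contDiffOn_const.mul h1).sub (contDiffOn_const.mul h2))).prodMk
      (contDiffOn_const.mul (h1.sub h2))
  · rintro z ⟨hzJ, hzK⟩
    have dJ := (hJ.differentiableAt (isOpen_slicePreimage hΩ J) hzJ).hasFDerivAt
    have dK := (hK.differentiableAt (isOpen_slicePreimage hΩ K) hzK).hasFDerivAt
    have eJ := hJ.dbar z hzJ
    have eK := hK.dbar z hzK
    set A := fderiv ℝ (fun w => f (slicePoint J w)) z
    set B := fderiv ℝ (fun w => f (slicePoint K w)) z
    have hV := ((dJ.const_mul (J : ℍ[ℝ])).sub (dK.const_mul (K : ℍ[ℝ]))).const_mul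
      ((J : ℍ[ℝ]) - K)⁻¹
    have hW := (dJ.sub dK).const_mul ((J : ℍ[ℝ]) - K)⁻¹
    have hVW : HasFDerivAt (repStem f J K) _ z := hV.prodMk hW
    have eJ' : A 1 = -(J * A Complex.I) := eq_neg_of_add_eq_zero_left eJ
    have eK' : B 1 = -(K * B Complex.I) := eq_neg_of_add_eq_zero_left eK
    rw [hVW.fderiv]
    simp only [ContinuousLinearMap.prod_apply, smul_apply, sub_apply, smul_eq_mul, iotaCLM_apply,
      iotaMul, eJ', eK', Prod.mk_add_mk, mul_neg, ← mul_assoc (J : ℍ[ℝ]) J,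
      ← mul_assoc (K : ℍ[ℝ]) K, mul_self_imagUnits, Prod.mk_eq_zero, ← mul_add]
    constructor
    · rw [← sub_eq_add_neg, ← mul_sub]; simp
    · simp

lemma holomorphicWrt_representation (hΩ : IsOpen Ω) (hf : IsSliceRegular Ω f)
    (I J K : imagUnits) :
    HolomorphicWrt (unitCLM I) (fun z => repValue f J K z + (I : ℍ[ℝ]) * repDeriv f J K z)
      (slicePoint J ⁻¹' Ω ∩ slicePoint K ⁻¹' Ω) := by
  have h := holomorphicWrt_repStem hΩ hf J K
  have hO := (isOpen_slicePreimage hΩ J).inter (isOpen_slicePreimage hΩ K)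
  constructor
  · exact (contDiff_fst.comp_contDiffOn h.contDiffOn).add
      (contDiffOn_const.mul (contDiff_snd.comp_contDiffOn h.contDiffOn))
  · intro z hz
    have d := (h.differentiableAt hO hz).hasFDerivAt
    have e := h.dbar z hz
    set A := fderiv ℝ (repStem f J K) z
    have hd : HasFDerivAt (fun z => repValue f J K z + (I : ℍ[ℝ]) * repDeriv f J K z) _ z :=
      d.fst.add (d.snd.const_mul (I : ℍ[ℝ]))
    have e' : A 1 = -iotaMul (A Complex.I) := eq_neg_of_add_eq_zero_left e
    rw [hd.fderiv]
    simp only [add_apply, smul_apply, ContinuousLinearMap.comp_apply, e', iotaMul, smul_eq_mul,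
      unitCLM_apply, ContinuousLinearMap.coe_fst', ContinuousLinearMap.coe_snd', Prod.fst_neg,
      Prod.snd_neg, mul_add, ← mul_assoc (I : ℍ[ℝ]) I, mul_self_imagUnits]
    simp

/-- All the double-index stem functions defined on a speared open set coincide there, since they
coincide with `f` at its real points. -/
lemma repStem_eq_repStem (hΩ : IsOpen Ω) (hf : IsSliceRegular Ω f) {U : Set ℂ}
    (hU : IsSpearedOpenC U) {J K J' K' : imagUnits} (hJK : J ≠ K) (hJK' : J' ≠ K')
    (hJ : U ⊆ slicePoint J ⁻¹' Ω) (hK : U ⊆ slicePoint K ⁻¹' Ω)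
    (hJ' : U ⊆ slicePoint J' ⁻¹' Ω) (hK' : U ⊆ slicePoint K' ⁻¹' Ω) :
    Set.EqOn (repStem f J K) (repStem f J' K') U := by
  intro z hz
  refine sub_eq_zero.1 (HolomorphicWrt.eqOn_zero_of_speared iotaCLM_iotaCLM hU
    (((holomorphicWrt_repStem hΩ hf J K).mono (Set.subset_inter hJ hK)).sub hU.1
      ((holomorphicWrt_repStem hΩ hf J' K').mono (Set.subset_inter hJ' hK'))) ?_ z hz)
  intro a _
  rw [repStem_ofReal f hJK, repStem_ofReal f hJK', sub_self]

/-- The representation formula over a speared open subset of `ℝ_ℂ`. -/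
lemma representation_formula (hΩ : IsOpen Ω) (hf : IsSliceRegular Ω f) {U : Set ℂ}
    (hU : IsSpearedOpenC U) {I J K : imagUnits} (hJK : J ≠ K)
    (hI : U ⊆ slicePoint I ⁻¹' Ω) (hJ : U ⊆ slicePoint J ⁻¹' Ω)
    (hK : U ⊆ slicePoint K ⁻¹' Ω) {z : ℂ} (hz : z ∈ U) :
    f (slicePoint I z) = repValue f J K z + (I : ℍ[ℝ]) * repDeriv f J K z := by
  refine sub_eq_zero.1 (HolomorphicWrt.eqOn_zero_of_speared (unitCLM_unitCLM I) hU
    (((hf.holomorphicWrt I).mono hI).sub hU.1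
      ((holomorphicWrt_representation hΩ hf I J K).mono (Set.subset_inter hJ hK))) ?_ z hz)
  intro a _
  simp [repValue_of_im_eq_zero f hJK (Complex.ofReal_im a),
    repDeriv_of_im_eq_zero f J K (Complex.ofReal_im a)]

end Holomorphy

/-! ### The core -/

section Core

variable {Ω : Set ℍ[ℝ]}

lemma isOpen_core (Ω : Set ℍ[ℝ]) : IsOpen (core Ω) := isOpen_sUnion fun _ hV => hV.1.1

lemma core_subset (Ω : Set ℍ[ℝ]) : core Ω ⊆ Ω := Set.sUnion_subset fun _ hV => hV.2.2

lemma slicePoint_mem_core (J : imagUnits) {K : imagUnits} {z : ℂ}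
    (h : slicePoint K z ∈ core Ω) : slicePoint J z ∈ core Ω := by
  obtain ⟨V, hV, hz⟩ := h
  exact ⟨V, hV, hV.2.1 _ hz ⟨z, K, J, rfl, rfl⟩⟩

lemma coreC_eq_preimage (Ω : Set ℍ[ℝ]) (J : imagUnits) : coreC Ω = slicePoint J ⁻¹' core Ω :=
  Set.ext fun _ => ⟨fun ⟨_, h⟩ => slicePoint_mem_core J h, fun h => ⟨J, h⟩⟩

lemma slicePoint_mem_core_iff (J : imagUnits) {z : ℂ} : slicePoint J z ∈ core Ω ↔ z ∈ coreC Ω := by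
  rw [coreC_eq_preimage Ω J]; rfl

lemma coreC_subset_preimage (Ω : Set ℍ[ℝ]) (J : imagUnits) : coreC Ω ⊆ slicePoint J ⁻¹' Ω :=
  fun _ hz => core_subset Ω ((slicePoint_mem_core_iff J).2 hz)

lemma conj_mem_coreC {z : ℂ} (hz : z ∈ coreC Ω) : (starRingEnd ℂ) z ∈ coreC Ω := by
  obtain ⟨J, hJ⟩ := hz
  exact ⟨-J, by rwa [slicePoint_neg_conj]⟩

lemma conj_mem_coreC_iff {z : ℂ} : (starRingEnd ℂ) z ∈ coreC Ω ↔ z ∈ coreC Ω :=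
  ⟨fun h => by simpa using conj_mem_coreC h, conj_mem_coreC⟩

lemma convex_halfPlane (I : imagUnits) : Convex ℝ (halfPlane I) := by
  rintro x ⟨z, hz, rfl⟩ y ⟨w, hw, rfl⟩ a b ha hb hab
  refine ⟨a • z + b • w, by simp; positivity, ?_⟩
  simp only [slicePoint, Complex.add_re, Complex.add_im, Complex.real_smul, Complex.re_ofReal_mul,
    Complex.im_ofReal_mul, Quaternion.coe_add, Quaternion.coe_mul, ← Quaternion.coe_mul_eq_smul]
  simp only [mul_add, add_mul, mul_assoc]
  abel

lemma coe_mem_halfPlane (I : imagUnits) (a : ℝ) : (a : ℍ[ℝ]) ∈ halfPlane I :=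
  ⟨a, by simp, by simp⟩

/-- Balls centred at real points are symmetric speared open sets. -/
lemma coe_mem_core (hΩ : IsOpen Ω) {a : ℝ} (ha : (a : ℍ[ℝ]) ∈ Ω) : (a : ℍ[ℝ]) ∈ core Ω := by
  obtain ⟨r, hr, hball⟩ := Metric.isOpen_iff.1 hΩ _ ha
  refine ⟨Metric.ball (a : ℍ[ℝ]) r, ⟨⟨Metric.isOpen_ball, fun I x hx => ⟨a, ?_⟩⟩, ?_, hball⟩,
    Metric.mem_ball_self hr⟩
  · have hc : Convex ℝ (halfSlice (Metric.ball (a : ℍ[ℝ]) r) I) :=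
      (convex_ball _ _).inter (convex_halfPlane I)
    exact hc.isPreconnected.subset_connectedComponentIn hx subset_rfl
      ⟨Metric.mem_ball_self hr, coe_mem_halfPlane I a⟩
  · rintro x hx y ⟨z, I, J, rfl, rfl⟩
    rw [mem_ball_iff_norm, norm_slicePoint_sub_coe] at hx ⊢
    exact hx

lemma mem_coreC_of_im_eq_zero (hΩ : IsOpen Ω) {J : imagUnits} {z : ℂ} (hz : slicePoint J z ∈ Ω)
    (him : z.im = 0) : z ∈ coreC Ω := by
  refine ⟨J, ?_⟩
  rw [slicePoint_of_im_eq_zero J him] at hz ⊢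
  exact coe_mem_core hΩ hz

lemma isOpen_coreC (Ω : Set ℍ[ℝ]) : IsOpen (coreC Ω) := by
  by_cases h : Nonempty imagUnits
  · obtain ⟨J⟩ := h
    rw [coreC_eq_preimage Ω J]
    exact isOpen_slicePreimage (isOpen_core Ω) J
  · have : coreC Ω = ∅ := Set.eq_empty_of_forall_notMem fun z ⟨J, _⟩ => h ⟨J⟩
    rw [this]; exact isOpen_empty

/-- A connected component in `W` transported by complex conjugation. -/
lemma conj_mem_connectedComponentIn {W W' : Set ℂ} (hW : ∀ w ∈ W, (starRingEnd ℂ) w ∈ W') {z : ℂ}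
    (hz : z ∈ W) {a : ℝ} (ha : (a : ℂ) ∈ connectedComponentIn W z) :
    (a : ℂ) ∈ connectedComponentIn W' ((starRingEnd ℂ) z) := by
  have h := (isPreconnected_connectedComponentIn (F := W) (x := z)).image (starRingEnd ℂ)
    Complex.continuous_conj.continuousOn
  refine h.subset_connectedComponentIn ⟨z, mem_connectedComponentIn hz, rfl⟩ ?_
    ⟨a, ha, Complex.conj_ofReal a⟩
  rintro _ ⟨w, hw, rfl⟩
  exact hW w (connectedComponentIn_subset W z hw)

lemma isSpearedOpenC_coreC (Ω : Set ℍ[ℝ]) : IsSpearedOpenC (coreC Ω) := by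
  refine ⟨isOpen_coreC Ω, fun z hz => ?_⟩
  have key : ∀ z ∈ coreC Ω, 0 ≤ z.im → ∃ a : ℝ, (a : ℂ) ∈ connectedComponentIn (coreC Ω) z := by
    rintro z ⟨J, V, hV, hz⟩ him
    have hx : slicePoint J z ∈ halfSlice V J := ⟨hz, z, him, rfl⟩
    obtain ⟨a, ha⟩ := hV.1.2 J _ hx
    refine ⟨a, ((isPreconnected_connectedComponentIn.image foldHalf
      continuous_foldHalf.continuousOn).subset_connectedComponentIn
        ⟨_, mem_connectedComponentIn hx, foldHalf_slicePoint J him⟩ ?_) ⟨a, ha, ?_⟩⟩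
    · rintro _ ⟨y, hy, rfl⟩
      obtain ⟨hyV, w, hw, rfl⟩ := connectedComponentIn_subset _ _ hy
      rw [foldHalf_slicePoint J hw]
      exact ⟨J, V, hV, hyV⟩
    · rw [← slicePoint_ofReal J, foldHalf_slicePoint J (by simp)]
  rcases le_total 0 z.im with h | h
  · exact key z hz h
  · obtain ⟨a, ha⟩ := key _ (conj_mem_coreC hz) (by simpa using h)
    exact ⟨a, by simpa using
      conj_mem_connectedComponentIn (fun _ => conj_mem_coreC) (conj_mem_coreC hz) ha⟩

end Core


/-! ### Speared neighbourhoods common to all nearby slices -/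

/-- `U` is a speared open subset of `ℝ_ℂ` that includes the core, exceeds it only in the open upper
half-plane, and is mapped into `Ω` by `φ_I` for all `I` at distance less than `ε` from `J`. -/
structure IsAdapted (Ω : Set ℍ[ℝ]) (J : imagUnits) (ε : ℝ) (U : Set ℂ) : Prop where
  pos : 0 < ε
  speared : IsSpearedOpenC U
  core_subset : coreC Ω ⊆ U
  im_pos : U \ coreC Ω ⊆ {w | 0 < w.im}
  subset_preimage : ∀ I : imagUnits, dist I J < ε → U ⊆ slicePoint I ⁻¹' Ω

lemma isAdapted_coreC (Ω : Set ℍ[ℝ]) (J : imagUnits) {ε : ℝ} (hε : 0 < ε) :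
    IsAdapted Ω J ε (coreC Ω) :=
  ⟨hε, isSpearedOpenC_coreC Ω, subset_rfl, by simp, fun I _ => coreC_subset_preimage Ω I⟩

/-- An adapted set can be enlarged by the part in the open upper half-plane of a ball which meets it
in the closed upper half-plane. -/
lemma IsAdapted.union_ball {Ω : Set ℍ[ℝ]} {J : imagUnits} {ε δ r : ℝ} {U : Set ℂ} {c w : ℂ}
    (hU : IsAdapted Ω J ε U) (hδ : 0 < δ)
    (hball : ∀ I : imagUnits, dist I J < δ → Metric.ball c r ⊆ slicePoint I ⁻¹' Ω)
    (hw : w ∈ Metric.ball c r) (hwU : w ∈ U) (him : 0 ≤ w.im) :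
    IsAdapted Ω J (min ε δ) (U ∪ Metric.ball c r ∩ {z | 0 < z.im}) := by
  have hO : IsOpen {z : ℂ | 0 < z.im} := isOpen_lt continuous_const Complex.continuous_im
  refine ⟨lt_min hU.pos hδ, ⟨hU.speared.1.union (Metric.isOpen_ball.inter hO), ?_⟩,
    hU.core_subset.trans Set.subset_union_left, ?_, ?_⟩
  · have key : ∀ z ∈ U, ∃ a : ℝ, (a : ℂ) ∈
        connectedComponentIn (U ∪ Metric.ball c r ∩ {z | 0 < z.im}) z := fun z hz => by
      obtain ⟨a, ha⟩ := hU.speared.2 z hz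
      exact ⟨a, connectedComponentIn_mono z Set.subset_union_left ha⟩
    rintro z (hz | ⟨hz, hzim⟩)
    · exact key z hz
    · obtain ⟨a, ha⟩ := key w hwU
      have hseg : segment ℝ z w ⊆ U ∪ Metric.ball c r ∩ {z | 0 < z.im} := by
        rintro y ⟨s, t, hs, ht, hst, rfl⟩
        rcases hs.eq_or_lt with rfl | hs
        · rw [zero_add] at hst; subst hst
          left; simpa using hwU
        · refine Or.inr ⟨convex_ball c r hz hw hs.le ht hst, ?_⟩
          have h1 : 0 < s * z.im := mul_pos hs hzim
          have h2 : 0 ≤ t * w.im := mul_nonneg ht him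
          simp only [Set.mem_ofPred_eq, Complex.add_im, Complex.real_smul, Complex.im_ofReal_mul]
          linarith
      have hzw : w ∈ connectedComponentIn (U ∪ Metric.ball c r ∩ {z | 0 < z.im}) z :=
        (convex_segment z w).isPreconnected.subset_connectedComponentIn (left_mem_segment ℝ z w)
          hseg (right_mem_segment ℝ z w)
      exact ⟨a, by rwa [connectedComponentIn_eq hzw]⟩
  · rintro z ⟨hz | hz, hzc⟩
    · exact hU.im_pos ⟨hz, hzc⟩
    · exact hz.2
  · intro I hI
    exact Set.union_subset (hU.subset_preimage I (hI.trans_le (min_le_left _ _)))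
      (Set.inter_subset_left.trans (hball I (hI.trans_le (min_le_right _ _))))

/-- The set of points of `φ_J⁻¹(Ω_J^≥)` having an adapted neighbourhood includes the real points and
is relatively open and closed, so it is everything because `Ω` is speared. -/
theorem exists_isAdapted {Ω : Set ℍ[ℝ]} (hΩ : IsSpearedOpen Ω) {J : imagUnits} {z : ℂ}
    (hz : z ∈ halfDom Ω J) : ∃ ε U, IsAdapted Ω J ε U ∧ z ∈ U := by
  obtain ⟨hzΩ, him⟩ := mem_halfDom.1 hz
  have hx : slicePoint J z ∈ halfSlice Ω J := ⟨hzΩ, z, him, rfl⟩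
  obtain ⟨a, ha⟩ := hΩ.2 J _ hx
  -- The connected subset of the closed upper half-plane that joins `z` to the real axis.
  set C := foldHalf '' connectedComponentIn (halfSlice Ω J) (slicePoint J z) with hC
  have hCconn : IsPreconnected C :=
    isPreconnected_connectedComponentIn.image _ continuous_foldHalf.continuousOn
  have hzC : z ∈ C := ⟨_, mem_connectedComponentIn hx, foldHalf_slicePoint J him⟩
  have haC : (a : ℂ) ∈ C :=
    ⟨a, ha, by rw [← slicePoint_ofReal J, foldHalf_slicePoint J (by simp)]⟩
  have hCsub : C ⊆ halfDom Ω J := by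
    rintro _ ⟨y, hy, rfl⟩
    obtain ⟨hyΩ, w, hw, rfl⟩ := connectedComponentIn_subset _ _ hy
    rw [foldHalf_slicePoint J hw]
    exact mem_halfDom.2 ⟨hyΩ, hw⟩
  let P : ℂ → Prop := fun w => ∃ ε U, IsAdapted Ω J ε U ∧ w ∈ U
  have hreal : ∀ w ∈ C, w.im = 0 → P w := fun w hw h0 =>
    ⟨1, coreC Ω, isAdapted_coreC Ω J one_pos,
      mem_coreC_of_im_eq_zero hΩ.1 (mem_halfDom.1 (hCsub hw)).1 h0⟩
  have hloc : ∀ w ∈ C, ∀ᶠ y in 𝓝[C] w, (P w → P y) ∧ (P y → P w) := by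
    intro w hw
    have hnhds : (fun p : imagUnits × ℂ => slicePoint p.1 p.2) ⁻¹' Ω ∈ 𝓝 (J, w) :=
      continuous_slicePoint₂.continuousAt (hΩ.1.mem_nhds (mem_halfDom.1 (hCsub hw)).1)
    obtain ⟨r, hr, hrΩ⟩ := Metric.mem_nhds_iff.1 hnhds
    have hball : ∀ I : imagUnits, dist I J < r → Metric.ball w r ⊆ slicePoint I ⁻¹' Ω :=
      fun I hI y hy => @hrΩ (I, y) (by
        rw [Metric.mem_ball, Prod.dist_eq]; exact max_lt hI hy)
    have htrans : ∀ y ∈ C, ∀ y' ∈ C, y ∈ Metric.ball w r → y' ∈ Metric.ball w r → P y → P y' := by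
      rintro y hy y' hy' hyb hyb' ⟨ε, U, hU, hyU⟩
      rcases (mem_halfDom.1 (hCsub hy')).2.eq_or_lt with h0 | h0
      · exact hreal y' hy' h0.symm
      · exact ⟨_, _, hU.union_ball hr hball hyb hyU (mem_halfDom.1 (hCsub hy)).2,
          Or.inr ⟨hyb', h0⟩⟩
    filter_upwards [self_mem_nhdsWithin, nhdsWithin_le_nhds (Metric.ball_mem_nhds w hr)]
      with y hy hyb
    exact ⟨htrans w hw y hy (Metric.mem_ball_self hr) hyb,
      htrans y hy w hw hyb (Metric.mem_ball_self hr)⟩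
  exact hCconn.induction₂' (fun x y => P x → P y) hloc
    (fun _ _ _ _ _ _ h h' => h' ∘ h) haC hzC (hreal _ haC (Complex.ofReal_im a))

/-! ### The holomorphic stem family -/

section StemFamily

variable {Ω : Set ℍ[ℝ]} {f : ℍ[ℝ] → ℍ[ℝ]}

namespace IsAdapted

variable {J J' K J'' K'' : imagUnits} {ε : ℝ} {U : Set ℂ} {z : ℂ}

lemma subset_stemDom (hU : IsAdapted Ω J ε U) {I : imagUnits} (hI : dist I J < ε) :
    U ⊆ stemDom Ω I := by
  intro z hz
  have hzI := hU.subset_preimage I hI hz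
  rcases le_or_gt 0 z.im with h | h
  · exact Or.inl (mem_halfDom.2 ⟨hzI, h⟩)
  · have hc : z ∈ coreC Ω := by
      by_contra hc
      exact lt_asymm h (hU.im_pos ⟨hz, hc⟩)
    exact Or.inr ⟨(starRingEnd ℂ) z,
      mem_halfDom.2 ⟨coreC_subset_preimage Ω I (conj_mem_coreC hc), by simpa using h.le⟩,
      Complex.conj_conj z⟩

lemma repStem_eq (hΩ : IsOpen Ω) (hf : IsSliceRegular Ω f) (hU : IsAdapted Ω J ε U)
    (hJK : J' ≠ K) (hJ' : dist J' J < ε) (hK : dist K J < ε) (hJK' : J'' ≠ K'')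
    (hJ'' : dist J'' J < ε) (hK'' : dist K'' J < ε) (hz : z ∈ U) :
    repStem f J' K z = repStem f J'' K'' z :=
  repStem_eq_repStem hΩ hf hU.speared hJK hJK' (hU.subset_preimage _ hJ')
    (hU.subset_preimage _ hK) (hU.subset_preimage _ hJ'') (hU.subset_preimage _ hK'') hz

/-- Below the real axis an adapted set is included in the core, where all the holomorphic functions
given by the explicit formula coincide. -/
lemma stem₂_eq (hΩ : IsOpen Ω) (hf : IsSliceRegular Ω f) (hU : IsAdapted Ω J ε U)
    (hJK : J' ≠ K) (hz : z ∈ U) : stem₂ f J' K z = repStem f J' K z := by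
  rcases le_or_gt 0 z.im with h | h
  · exact stem₂_of_nonneg f J' K h
  · have hc : z ∈ coreC Ω := by
      by_contra hc
      exact lt_asymm h (hU.im_pos ⟨hz, hc⟩)
    rw [stem₂_of_neg f J' K h]
    exact repStem_eq_repStem hΩ hf (isSpearedOpenC_coreC Ω) (neg_injective_imagUnits hJK) hJK
      (coreC_subset_preimage Ω _) (coreC_subset_preimage Ω _) (coreC_subset_preimage Ω _)
      (coreC_subset_preimage Ω _) hc

lemma tendsto_stem₂ (hΩ : IsOpen Ω) (hf : IsSliceRegular Ω f) (hU : IsAdapted Ω J ε U)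
    {I : imagUnits} (hI : dist I J < ε) (hJK : J' ≠ K) (hJ' : dist J' J < ε)
    (hK : dist K J < ε) (hz : z ∈ U) :
    Filter.Tendsto (fun L => stem₂ f I L z) (𝓝[≠] I) (𝓝 (repStem f J' K z)) := by
  refine tendsto_const_nhds.congr' ?_
  filter_upwards [self_mem_nhdsWithin,
    nhdsWithin_le_nhds (Metric.isOpen_ball.mem_nhds (Metric.mem_ball.2 hI))] with L hLI hL
  rw [hU.stem₂_eq hΩ hf (Ne.symm hLI) hz]
  exact hU.repStem_eq hΩ hf hJK hJ' hK (Ne.symm hLI) hI hL hz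

lemma stem_eq (hΩ : IsOpen Ω) (hf : IsSliceRegular Ω f) (hU : IsAdapted Ω J ε U)
    {I : imagUnits} (hI : dist I J < ε) (hJK : J' ≠ K) (hJ' : dist J' J < ε)
    (hK : dist K J < ε) (hz : z ∈ U) : stem f I z = repStem f J' K z :=
  (hU.tendsto_stem₂ hΩ hf hI hJK hJ' hK hz).limUnder_eq

/-- There is a second unit in any ball around `J`. -/
lemma exists_ne (hU : IsAdapted Ω J ε U) : ∃ K : imagUnits, J ≠ K ∧ dist K J < ε := by
  have h : ∀ᶠ K in 𝓝[≠] J, K ≠ J ∧ dist K J < ε :=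
    Filter.inter_mem self_mem_nhdsWithin (nhdsWithin_le_nhds (Metric.ball_mem_nhds J hU.pos))
  obtain ⟨K, h1, h2⟩ := h.exists
  exact ⟨K, h1.symm, h2⟩

/-- `J ↦ F^J` is locally constant, in a uniform way. -/
lemma stem_eq_stem (hΩ : IsOpen Ω) (hf : IsSliceRegular Ω f) (hU : IsAdapted Ω J ε U)
    {I : imagUnits} (hI : dist I J < ε) : Set.EqOn (stem f I) (stem f J) U := by
  intro z hz
  have hJ : dist J J < ε := by rw [dist_self]; exact hU.pos
  obtain ⟨K, hJK, hK⟩ := hU.exists_ne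
  rw [hU.stem_eq hΩ hf hI hJK hJ hK hz, hU.stem_eq hΩ hf hJ hJK hJ hK hz]

lemma holomorphicWrt_stem (hΩ : IsOpen Ω) (hf : IsSliceRegular Ω f) (hU : IsAdapted Ω J ε U) :
    HolomorphicWrt iotaCLM (stem f J) U := by
  have hJ : dist J J < ε := by rw [dist_self]; exact hU.pos
  obtain ⟨K, hJK, hK⟩ := hU.exists_ne
  exact ((holomorphicWrt_repStem hΩ hf J K).mono (Set.subset_inter (hU.subset_preimage J hJ)
    (hU.subset_preimage K hK))).congr hU.speared.1
      fun z hz => hU.stem_eq hΩ hf hJ hJK hJ hK hz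

end IsAdapted

lemma stem_eq_stem₂_of_mem_coreC (hΩ : IsOpen Ω) (hf : IsSliceRegular Ω f)
    {J J' K' : imagUnits} (hJK : J' ≠ K') {z : ℂ} (hz : z ∈ coreC Ω) :
    stem f J z = stem₂ f J' K' z := by
  have hε : 0 < max (dist J' J) (dist K' J) + 1 :=
    add_pos_of_nonneg_of_pos (le_max_of_le_left dist_nonneg) one_pos
  have hU := isAdapted_coreC Ω J hε
  rw [hU.stem₂_eq hΩ hf hJK hz]
  exact hU.stem_eq hΩ hf (by rwa [dist_self]) hJK
    ((le_max_left _ _).trans_lt (lt_add_one _)) ((le_max_right _ _).trans_lt (lt_add_one _)) hz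

lemma stem_eq_stem_of_mem_coreC (hΩ : IsOpen Ω) (hf : IsSliceRegular Ω f) (J J' : imagUnits)
    {z : ℂ} (hz : z ∈ coreC Ω) : stem f J z = stem f J' z := by
  obtain ⟨K, hJK, -⟩ := (isAdapted_coreC Ω J one_pos).exists_ne
  rw [stem_eq_stem₂_of_mem_coreC hΩ hf hJK hz, stem_eq_stem₂_of_mem_coreC hΩ hf hJK hz]

lemma stem_conj (hΩ : IsSpearedOpen Ω) (hf : IsSliceRegular Ω f) {J : imagUnits} {z : ℂ}
    (hz : z ∈ stemDom Ω J) : stem f J ((starRingEnd ℂ) z) = conjHC (stem f J z) := by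
  have key : ∀ z ∈ halfDom Ω J, stem f J ((starRingEnd ℂ) z) = conjHC (stem f J z) := by
    intro z hz
    obtain ⟨ε, U, hU, hzU⟩ := exists_isAdapted hΩ hz
    have hJ : dist J J < ε := by rw [dist_self]; exact hU.pos
    obtain ⟨K, hJK, hK⟩ := hU.exists_ne
    rw [hU.stem_eq hΩ.1 hf hJ hJK hJ hK hzU]
    refine Filter.Tendsto.limUnder_eq ?_
    simp only [stem₂_conj]
    exact continuous_conjHC.continuousAt.tendsto.comp
      (hU.tendsto_stem₂ hΩ.1 hf hJ hJK hJ hK hzU)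
  rcases hz with hz | ⟨w, hw, rfl⟩
  · exact key z hz
  · rw [key w hw, conjHC_conjHC, Complex.conj_conj]

lemma IsSpearedOpenC.conj {U : Set ℂ} (hU : IsSpearedOpenC U) :
    IsSpearedOpenC ((starRingEnd ℂ) ⁻¹' U) := by
  refine ⟨hU.1.preimage Complex.continuous_conj, fun z hz => ?_⟩
  obtain ⟨a, ha⟩ := hU.2 _ hz
  have h := conj_mem_connectedComponentIn (W := U) (W' := (starRingEnd ℂ) ⁻¹' U)
    (fun w hw => by simpa using hw) (Set.mem_preimage.1 hz) ha
  exact ⟨a, by rwa [Complex.conj_conj] at h⟩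

lemma stem_local_eq (hΩ : IsSpearedOpen Ω) (hf : IsSliceRegular Ω f) {J : imagUnits} {z : ℂ}
    (hz : z ∈ stemDom Ω J) : ∃ ε : ℝ, 0 < ε ∧ ∃ U : Set ℂ,
    IsSpearedOpenC U ∧ z ∈ U ∧ U ⊆ stemDom Ω J ∧ coreC Ω ⊆ U ∧
    (U \ coreC Ω ⊆ {w | 0 < w.im} ∨ U \ coreC Ω ⊆ {w | w.im < 0}) ∧
    ∀ J' K' : imagUnits, J' ≠ K' → dist J' J < ε → dist K' J < ε →
      U ⊆ stemDom₂ Ω J' K' ∧ Set.EqOn (stem₂ f J' K') (stem f J) U := by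
  have key : ∀ {ε U}, IsAdapted Ω J ε U → ∀ {J' K' : imagUnits}, J' ≠ K' → dist J' J < ε →
      dist K' J < ε → U ⊆ stemDom₂ Ω J' K' ∧ Set.EqOn (stem₂ f J' K') (stem f J) U := by
    intro ε U hU J' K' hJK hJ' hK'
    rw [stemDom₂_eq]
    refine ⟨Set.subset_inter (hU.subset_stemDom hJ') (hU.subset_stemDom hK'), fun w hw => ?_⟩
    rw [hU.stem₂_eq hΩ.1 hf hJK hw,
      hU.stem_eq hΩ.1 hf (by rw [dist_self]; exact hU.pos) hJK hJ' hK' hw]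
  rcases hz with hz | ⟨w, hw, rfl⟩
  · obtain ⟨ε, U, hU, hzU⟩ := exists_isAdapted hΩ hz
    exact ⟨ε, hU.pos, U, hU.speared, hzU, hU.subset_stemDom (by rw [dist_self]; exact hU.pos),
      hU.core_subset, Or.inl hU.im_pos, fun J' K' => key hU⟩
  · obtain ⟨ε, U, hU, hwU⟩ := exists_isAdapted hΩ hw
    have hUJ := hU.subset_stemDom (I := J) (by rw [dist_self]; exact hU.pos)
    refine ⟨ε, hU.pos, (starRingEnd ℂ) ⁻¹' U, hU.speared.conj, by simpa using hwU,
      fun y hy => ?_, fun y hy => hU.core_subset (conj_mem_coreC hy), Or.inr ?_, ?_⟩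
    · simpa using conj_mem_stemDom (hUJ hy)
    · rintro y ⟨hy, hyc⟩
      have h := hU.im_pos ⟨hy, fun h => hyc (conj_mem_coreC_iff.1 h)⟩
      simpa using h
    · intro J' K' hJK hJ' hK'
      obtain ⟨h1, h2⟩ := key hU hJK hJ' hK'
      constructor
      · intro y hy
        have h3 := h1 hy
        rw [stemDom₂_eq] at h3 ⊢
        exact ⟨by simpa using conj_mem_stemDom h3.1, by simpa using conj_mem_stemDom h3.2⟩
      · intro y hy
        have h3 := h2 hy
        rw [stem₂_conj, stem_conj hΩ hf (by simpa using conj_mem_stemDom (hUJ hy))] at h3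
        rw [← conjHC_conjHC (stem₂ f J' K' y), h3, conjHC_conjHC]

/-- The functions `F^{-J,-K}` and `F^{J,K}` are conjugate to each other, so `F^J` is given by the
former on the lower half-plane; this makes it holomorphic there. -/
theorem isHolomorphicStem_stem (hΩ : IsSpearedOpen Ω) (hf : IsSliceRegular Ω f) (J : imagUnits) :
    IsHolomorphicStem (stemDom Ω J) (stem f J) := by
  have hloc : ∀ z ∈ stemDom Ω J, ∃ U, IsOpen U ∧ z ∈ U ∧ HolomorphicWrt iotaCLM (stem f J) U := by
    rintro z (hz | ⟨w, hw, rfl⟩)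
    · obtain ⟨ε, U, hU, hzU⟩ := exists_isAdapted hΩ hz
      exact ⟨U, hU.speared.1, hzU, hU.holomorphicWrt_stem hΩ.1 hf⟩
    · obtain ⟨ε, U, hU, hwU⟩ := exists_isAdapted hΩ hw
      have hJ : dist J J < ε := by rw [dist_self]; exact hU.pos
      obtain ⟨K, hJK, hK⟩ := hU.exists_ne
      have hO := hU.speared.1.preimage Complex.continuous_conj
      refine ⟨_, hO, by simpa using hwU,
        ((holomorphicWrt_repStem hΩ.1 hf (-J) (-K)).mono fun y hy => ?_).congr hO fun y hy => ?_⟩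
      · have h1 := hU.subset_preimage J hJ hy
        have h2 := hU.subset_preimage K hK hy
        rw [Set.mem_preimage, slicePoint_conj] at h1 h2
        exact ⟨h1, h2⟩
      · have h1 := stem_conj hΩ hf (hU.subset_stemDom hJ hy)
        rw [Complex.conj_conj] at h1
        rw [h1, hU.stem_eq hΩ.1 hf hJ hJK hJ hK hy, conjHC_repStem_conj]
  refine ⟨isOpen_iff_forall_mem_open.2 fun z hz => ?_, fun z => conj_mem_stemDom,
    fun z => stem_conj hΩ hf, fun z hz => ?_, fun z hz => ?_⟩
  · obtain ⟨-, -, U, hU, hzU, hUJ, -⟩ := stem_local_eq hΩ hf hz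
    exact ⟨U, hUJ, hU.1, hzU⟩
  · obtain ⟨U, hU, hzU, h⟩ := hloc z hz
    exact (h.contDiffOn.contDiffAt (hU.mem_nhds hzU)).contDiffWithinAt
  · obtain ⟨U, hU, hzU, h⟩ := hloc z hz
    exact h.dbar z hzU

theorem isHolomorphicStemFamily_stem (hΩ : IsSpearedOpen Ω) (hf : IsSliceRegular Ω f) :
    IsHolomorphicStemFamily Ω f (stem f) :=
  ⟨isHolomorphicStem_stem hΩ hf, fun _ _ => stem_local_eq hΩ hf,
    fun _ _ _ hJK _ hz => (stem_eq_stem₂_of_mem_coreC hΩ.1 hf hJK hz).symm⟩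

end StemFamily


/-! ### Spherical values and spherical derivatives -/

/-- The set of all `φ_I(z)` with `z` in a set adapted to `J₀` whose radius exceeds the distance of
`I` from `J₀`. It serves as the set `Λ` of the representation formula. -/
def adaptedSet (Ω : Set ℍ[ℝ]) (J₀ : imagUnits) : Set ℍ[ℝ] :=
  {q | ∃ (I : imagUnits) (z : ℂ), 0 ≤ z.im ∧ q = slicePoint I z ∧
    ∃ ε U, IsAdapted Ω J₀ ε U ∧ dist I J₀ < ε ∧ z ∈ U}

section Spherical

variable {Ω : Set ℍ[ℝ]} {f : ℍ[ℝ] → ℍ[ℝ]} {J₀ : imagUnits}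

lemma exists_isAdapted_of_mem_coreC (I : imagUnits) {z : ℂ} (hz : z ∈ coreC Ω) :
    ∃ ε U, IsAdapted Ω J₀ ε U ∧ dist I J₀ < ε ∧ z ∈ U :=
  ⟨dist I J₀ + 1, coreC Ω, isAdapted_coreC Ω J₀ (by positivity), by linarith, hz⟩

/-- The choice of `(I, z)` in the definition of `adaptedSet` is immaterial: it matters only for real
quaternions, and real points of adapted sets belong to the core. -/
lemma slicePoint_mem_adaptedSet {I : imagUnits} {z : ℂ} (hz : 0 ≤ z.im) :
    slicePoint I z ∈ adaptedSet Ω J₀ ↔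
      ∃ ε U, IsAdapted Ω J₀ ε U ∧ dist I J₀ < ε ∧ z ∈ U := by
  refine ⟨fun ⟨I', w, hw, h, ε, U, hU, hI', hwU⟩ => ?_, fun h => ⟨I, z, hz, rfl, h⟩⟩
  obtain ⟨rfl, h0 | rfl⟩ := slicePoint_inj hz hw h
  · refine exists_isAdapted_of_mem_coreC I ?_
    by_contra hc
    exact (hU.im_pos ⟨hwU, hc⟩ : 0 < z.im).ne' h0
  · exact ⟨ε, U, hU, hI', hwU⟩

lemma core_subset_adaptedSet (Ω : Set ℍ[ℝ]) (J₀ : imagUnits) : core Ω ⊆ adaptedSet Ω J₀ := by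
  intro q hq
  obtain ⟨I, hI⟩ := exists_slicePoint q J₀
  exact ⟨I, foldHalf q, norm_nonneg _, hI,
    exists_isAdapted_of_mem_coreC I ((slicePoint_mem_core_iff I).1 (hI ▸ hq))⟩

lemma isOpen_adaptedSet (Ω : Set ℍ[ℝ]) (J₀ : imagUnits) : IsOpen (adaptedSet Ω J₀) := by
  rw [isOpen_iff_mem_nhds]
  rintro q ⟨I, z, hz, hq, ε, U, hU, hI, hzU⟩
  by_cases hc : z ∈ coreC Ω
  · exact Filter.mem_of_superset ((isOpen_core Ω).mem_nhds
      (hq ▸ (slicePoint_mem_core_iff I).2 hc)) (core_subset_adaptedSet Ω J₀)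
  have him : 0 < z.im := hU.im_pos ⟨hzU, hc⟩
  have hqim : q.im = z.im • (I : ℍ[ℝ]) := by rw [hq, slicePoint_im]
  have hn : ‖q.im‖ = z.im := by
    rw [hqim, norm_smul, norm_imagUnits, mul_one, Real.norm_of_nonneg him.le]
  have hq0 : q.im ≠ 0 := norm_pos_iff.1 (hn ▸ him)
  have hdir : ‖q.im‖⁻¹ • q.im = I := by rw [hn, hqim, smul_smul, inv_mul_cancel₀ him.ne', one_smul]
  have hcont : ContinuousAt (fun q : ℍ[ℝ] => ‖q.im‖⁻¹ • q.im) q := by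
    have h := Quaternion.continuous_im.continuousAt (x := q)
    exact (h.norm.inv₀ (norm_ne_zero_iff.2 hq0)).smul h
  have e1 : ∀ᶠ p in 𝓝 q, p.im ≠ 0 := Quaternion.continuous_im.continuousAt.eventually_ne hq0
  have e2 : ∀ᶠ p in 𝓝 q, foldHalf p ∈ U :=
    continuous_foldHalf.continuousAt.eventually
      (hU.speared.1.mem_nhds (by rwa [hq, foldHalf_slicePoint I hz]))
  have e3 : ∀ᶠ p : ℍ[ℝ] in 𝓝 q, ‖p.im‖⁻¹ • p.im ∈ Metric.ball (J₀ : ℍ[ℝ]) ε := by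
    refine hcont.eventually (Metric.isOpen_ball.mem_nhds ?_)
    beta_reduce
    rw [hdir]; exact hI
  filter_upwards [e1, e2, e3] with p h1 h2 h3
  obtain ⟨I', hI', hp⟩ := exists_slicePoint_of_im_ne_zero h1
  rw [← hI'] at h3
  exact ⟨I', foldHalf p, norm_nonneg _, hp, ε, U, hU, h3, h2⟩

/-- A path to the real axis within an adapted set can be reflected into the closed upper half-plane,
since the part below the real axis belongs to the core. -/
lemma isSpearedOpen_adaptedSet (Ω : Set ℍ[ℝ]) (J₀ : imagUnits) :
    IsSpearedOpen (adaptedSet Ω J₀) := by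
  refine ⟨isOpen_adaptedSet Ω J₀, ?_⟩
  rintro I _ ⟨hx, z, hz, rfl⟩
  obtain ⟨ε, U, hU, hI, hzU⟩ := (slicePoint_mem_adaptedSet hz).1 hx
  obtain ⟨a, ha⟩ := hU.speared.2 z hzU
  let r : ℂ → ℂ := fun w => (w.re : ℂ) + (|w.im| : ℝ) * Complex.I
  have hr0 : ∀ w : ℂ, 0 ≤ (r w).im := fun w => by simp [r]
  have hr1 : ∀ w : ℂ, 0 ≤ w.im → r w = w := fun w hw => by
    simp only [r, abs_of_nonneg hw, Complex.re_add_im]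
  have hrU : ∀ w ∈ U, r w ∈ U := by
    intro w hw
    rcases le_or_gt 0 w.im with h | h
    · rwa [hr1 w h]
    · have hc : w ∈ coreC Ω := by
        by_contra hc
        exact lt_asymm h (hU.im_pos ⟨hw, hc⟩)
      have : r w = (starRingEnd ℂ) w := by
        apply Complex.ext <;> simp [r, abs_of_neg h]
      rw [this]
      exact hU.core_subset (conj_mem_coreC hc)
  have hrc : Continuous (fun w => slicePoint I (r w)) :=
    (continuous_slicePoint I).comp (by fun_prop)
  refine ⟨a, (isPreconnected_connectedComponentIn.image _ hrc.continuousOn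
    (s := connectedComponentIn U z)).subset_connectedComponentIn
      ⟨z, mem_connectedComponentIn hzU, congrArg _ (hr1 z hz)⟩ ?_
      ⟨a, ha, (congrArg _ (hr1 a (by simp))).trans (slicePoint_ofReal I a)⟩⟩
  rintro _ ⟨w, hw, rfl⟩
  exact ⟨(slicePoint_mem_adaptedSet (hr0 w)).2
    ⟨ε, U, hU, hI, hrU w (connectedComponentIn_subset U z hw)⟩, r w, hr0 w, rfl⟩

/-- Of several adapted sets, the one with the largest radius works for all the units involved. -/
theorem isRepresentationSet_adaptedSet (hΩ : IsSpearedOpen Ω) (hf : IsSliceRegular Ω f)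
    (J₀ : imagUnits) : IsRepresentationSet Ω f J₀ (adaptedSet Ω J₀) := by
  refine ⟨isSpearedOpen_adaptedSet Ω J₀, ?_, core_subset_adaptedSet Ω J₀, ?_, ?_⟩
  · rintro _ ⟨I, z, -, rfl, ε, U, hU, hI, hzU⟩
    exact hU.subset_preimage I hI hzU
  · rintro _ ⟨hx, z, hz, rfl⟩
    obtain ⟨ε, U, hU, hzU⟩ := exists_isAdapted hΩ (mem_halfDom.2 ⟨hx, hz⟩)
    exact ⟨J₀, z, hz, rfl, ε, U, hU, by rw [dist_self]; exact hU.pos, hzU⟩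
  · intro I J K z hJK hz hI hJ hK
    obtain ⟨ε₁, U₁, hU₁, hI, h₁⟩ := (slicePoint_mem_adaptedSet hz).1 hI
    obtain ⟨ε₂, U₂, hU₂, hJ, h₂⟩ := (slicePoint_mem_adaptedSet hz).1 hJ
    obtain ⟨ε₃, U₃, hU₃, hK, h₃⟩ := (slicePoint_mem_adaptedSet hz).1 hK
    have key : ∀ {ε U}, IsAdapted Ω J₀ ε U → z ∈ U → ε₁ ≤ ε → ε₂ ≤ ε → ε₃ ≤ ε →
        f (slicePoint I z) = repValue f J K z + (I : ℍ[ℝ]) * repDeriv f J K z :=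
      fun hU hzU l1 l2 l3 => representation_formula hΩ.1 hf hU.speared hJK
        (hU.subset_preimage I (hI.trans_le l1)) (hU.subset_preimage J (hJ.trans_le l2))
        (hU.subset_preimage K (hK.trans_le l3)) hzU
    rcases le_total ε₁ ε₂ with a | a
    · rcases le_total ε₂ ε₃ with b | b
      · exact key hU₃ h₃ (a.trans b) b le_rfl
      · exact key hU₂ h₂ a le_rfl b
    · rcases le_total ε₁ ε₃ with b | b
      · exact key hU₃ h₃ b (a.trans b) le_rfl
      · exact key hU₁ h₁ le_rfl a b

lemma stem_eq_repStem_of_mem_adaptedSet (hΩ : IsSpearedOpen Ω) (hf : IsSliceRegular Ω f)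
    {J K : imagUnits} (hJK : J ≠ K) {z : ℂ} (hz : 0 ≤ z.im)
    (hJ : slicePoint J z ∈ adaptedSet Ω J₀) (hK : slicePoint K z ∈ adaptedSet Ω J₀) :
    stem f J₀ z = repStem f J K z := by
  obtain ⟨ε₁, U₁, hU₁, hJ, h₁⟩ := (slicePoint_mem_adaptedSet hz).1 hJ
  obtain ⟨ε₂, U₂, hU₂, hK, h₂⟩ := (slicePoint_mem_adaptedSet hz).1 hK
  rcases le_total ε₁ ε₂ with a | a
  · exact hU₂.stem_eq hΩ.1 hf (by rw [dist_self]; exact hU₂.pos) hJK (hJ.trans_le a) hK h₂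
  · exact hU₁.stem_eq hΩ.1 hf (by rw [dist_self]; exact hU₁.pos) hJK hJ (hK.trans_le a) h₁

lemma isSphericalValue_stem (hΩ : IsSpearedOpen Ω) (hf : IsSliceRegular Ω f) {J : imagUnits}
    {z : ℂ} (hz : z ∈ halfDom Ω J) : IsSphericalValue Ω f (slicePoint J z) (stem f J z).1 := by
  obtain ⟨hzΩ, him⟩ := mem_halfDom.1 hz
  refine ⟨hzΩ, J, z, adaptedSet Ω J, him, rfl, isRepresentationSet_adaptedSet hΩ hf J,
    fun J' K hJK hJ' hK => ?_⟩
  rw [stem_eq_repStem_of_mem_adaptedSet hΩ hf hJK him hJ' hK, repStem]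

lemma isSphericalDerivative_stem (hΩ : IsSpearedOpen Ω) (hf : IsSliceRegular Ω f) {J : imagUnits}
    {z : ℂ} (hz : z ∈ halfDom Ω J) (hpos : 0 < z.im) :
    IsSphericalDerivative Ω f (slicePoint J z) ((z.im)⁻¹ • (stem f J z).2) := by
  obtain ⟨hzΩ, him⟩ := mem_halfDom.1 hz
  refine ⟨hzΩ, J, z, adaptedSet Ω J, hpos, rfl, isRepresentationSet_adaptedSet hΩ hf J,
    fun J' K hJK hJ' hK => ?_⟩
  rw [stem_eq_repStem_of_mem_adaptedSet hΩ hf hJK him hJ' hK, repStem]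

/-- Two sets as in the representation formula at the same point have two points of the same sphere
in common, so that they give rise to the same spherical value and derivative. -/
lemma exists_ne_mem_inter {x : ℍ[ℝ]} {Λ Λ' : Set ℍ[ℝ]} {J J' : imagUnits} {z z' : ℂ}
    (hx : x ∈ Ω) (hz : 0 ≤ z.im) (hz' : 0 ≤ z'.im) (hxz : x = slicePoint J z)
    (hxz' : x = slicePoint J' z') (hΛ : IsRepresentationSet Ω f J Λ)
    (hΛ' : IsRepresentationSet Ω f J' Λ') :
    z = z' ∧ ∃ K : imagUnits, J ≠ K ∧ slicePoint J z ∈ Λ ∧ slicePoint K z ∈ Λ ∧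
      slicePoint J z ∈ Λ' ∧ slicePoint K z ∈ Λ' := by
  refine ⟨(slicePoint_inj hz hz' (hxz.symm.trans hxz')).1, ?_⟩
  have h1 : slicePoint J z ∈ Λ := hxz ▸ hΛ.halfSlice_subset ⟨hx, z, hz, hxz⟩
  have h2 : slicePoint J z ∈ Λ' := hxz ▸ hΛ'.halfSlice_subset ⟨hx, z', hz', hxz'⟩
  have hc : Continuous (fun K : imagUnits => slicePoint K z) :=
    continuous_slicePoint₂.comp (Continuous.prodMk_left z)
  have hev : ∀ᶠ K in 𝓝[≠] J, slicePoint K z ∈ Λ ∩ Λ' :=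
    nhdsWithin_le_nhds (hc.continuousAt ((hΛ.speared.1.inter hΛ'.speared.1).mem_nhds ⟨h1, h2⟩))
  obtain ⟨K, hK, hKJ⟩ := (hev.and self_mem_nhdsWithin).exists
  exact ⟨K, Ne.symm hKJ, h1, hK.1, h2, hK.2⟩

lemma IsSphericalValue.unique {x v v' : ℍ[ℝ]} (h : IsSphericalValue Ω f x v)
    (h' : IsSphericalValue Ω f x v') : v = v' := by
  obtain ⟨hx, J, z, Λ, hz, hxz, hΛ, hv⟩ := h
  obtain ⟨-, J', z', Λ', hz', hxz', hΛ', hv'⟩ := h'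
  obtain ⟨rfl, K, hJK, h1, h2, h3, h4⟩ := exists_ne_mem_inter hx hz hz' hxz hxz' hΛ hΛ'
  rw [hv J K hJK h1 h2, hv' J K hJK h3 h4]

lemma IsSphericalDerivative.unique {x v v' : ℍ[ℝ]} (h : IsSphericalDerivative Ω f x v)
    (h' : IsSphericalDerivative Ω f x v') : v = v' := by
  obtain ⟨hx, J, z, Λ, hz, hxz, hΛ, hv⟩ := h
  obtain ⟨-, J', z', Λ', hz', hxz', hΛ', hv'⟩ := h'
  obtain ⟨rfl, K, hJK, h1, h2, h3, h4⟩ := exists_ne_mem_inter hx hz.le hz'.le hxz hxz' hΛ hΛ'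
  rw [hv J K hJK h1 h2, hv' J K hJK h3 h4]

lemma sphericalValue_eq (hΩ : IsSpearedOpen Ω) (hf : IsSliceRegular Ω f) {J : imagUnits}
    {z : ℂ} (hz : z ∈ halfDom Ω J) :
    sphericalValue Ω f (slicePoint J z) = (stem f J z).1 := by
  have h := isSphericalValue_stem hΩ hf hz
  exact (Classical.epsilon_spec (p := IsSphericalValue Ω f (slicePoint J z)) ⟨_, h⟩).unique h

lemma sphericalDerivative_eq (hΩ : IsSpearedOpen Ω) (hf : IsSliceRegular Ω f) {J : imagUnits}
    {z : ℂ} (hz : z ∈ halfDom Ω J) (hpos : 0 < z.im) :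
    sphericalDerivative Ω f (slicePoint J z) = (z.im)⁻¹ • (stem f J z).2 := by
  have h := isSphericalDerivative_stem hΩ hf hz hpos
  exact (Classical.epsilon_spec (p := IsSphericalDerivative Ω f (slicePoint J z)) ⟨_, h⟩).unique h

lemma nonempty_imagUnits : Nonempty imagUnits := by
  have h : (⟨0, 1, 0, 0⟩ : ℍ[ℝ]).im ≠ 0 := fun h => by
    simpa using congrArg QuaternionAlgebra.imI h
  obtain ⟨J, -⟩ := exists_slicePoint_of_im_ne_zero h
  exact ⟨J⟩

theorem existsUnique_isSphericalValue (hΩ : IsSpearedOpen Ω) (hf : IsSliceRegular Ω f) {x : ℍ[ℝ]}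
    (hx : x ∈ Ω) : ∃! v, IsSphericalValue Ω f x v := by
  obtain ⟨J₀⟩ := nonempty_imagUnits
  obtain ⟨J, hJ⟩ := exists_slicePoint x J₀
  have h := isSphericalValue_stem hΩ hf (J := J) (z := foldHalf x)
    (mem_halfDom.2 ⟨hJ ▸ hx, norm_nonneg _⟩)
  rw [← hJ] at h
  exact ⟨_, h, fun v hv => hv.unique h⟩

theorem existsUnique_isSphericalDerivative (hΩ : IsSpearedOpen Ω) (hf : IsSliceRegular Ω f)
    {x : ℍ[ℝ]} (hx : x ∈ Ω) (hxr : x ∉ Set.range (fun a : ℝ => (a : ℍ[ℝ]))) :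
    ∃! v, IsSphericalDerivative Ω f x v := by
  have him : x.im ≠ 0 := fun h => hxr ⟨x.re, by
    change (x.re : ℍ[ℝ]) = x
    conv_rhs => rw [← Quaternion.re_add_im x, h, add_zero]⟩
  obtain ⟨J, -, hJ⟩ := exists_slicePoint_of_im_ne_zero him
  have h := isSphericalDerivative_stem hΩ hf (J := J) (z := foldHalf x)
    (mem_halfDom.2 ⟨hJ ▸ hx, norm_nonneg _⟩) (norm_pos_iff.2 him)
  rw [← hJ] at h
  exact ⟨_, h, fun v hv => hv.unique h⟩

end Spherical


/-! ### Hinged points -/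

/-- The points `x = α + β J` and `y = α + β K` of `Ω` belong to the same sphere, and the stem
functions `F^J` and `F^K` have the same germ at `α + ı β`. (For real points, the units `J` and `K`
may be chosen arbitrarily.) -/
def SameGerm (Ω : Set ℍ[ℝ]) (f : ℍ[ℝ] → ℍ[ℝ]) (x y : ℍ[ℝ]) : Prop :=
  x ∈ Ω ∧ y ∈ Ω ∧ ∃ (J K : imagUnits) (z : ℂ), 0 ≤ z.im ∧ x = slicePoint J z ∧
    y = slicePoint K z ∧ stem f J =ᶠ[𝓝 z] stem f K

section Hinged

variable {Ω : Set ℍ[ℝ]} {f : ℍ[ℝ] → ℍ[ℝ]}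

/-- The germ of the stem function at a point of `Ω` does not depend on the unit chosen to represent
that point. -/
lemma stem_eventuallyEq_of_slicePoint_eq (hΩ : IsOpen Ω) (hf : IsSliceRegular Ω f)
    {J K : imagUnits} {z w : ℂ} (hz : 0 ≤ z.im) (hw : 0 ≤ w.im) (hzΩ : slicePoint J z ∈ Ω)
    (h : slicePoint J z = slicePoint K w) : z = w ∧ stem f J =ᶠ[𝓝 z] stem f K := by
  obtain ⟨hzw, h0 | rfl⟩ := slicePoint_inj hz hw h
  · refine ⟨hzw, ?_⟩
    filter_upwards [(isOpen_coreC Ω).mem_nhds (mem_coreC_of_im_eq_zero hΩ hzΩ h0)] with y hy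
    exact stem_eq_stem_of_mem_coreC hΩ hf J K hy
  · exact ⟨hzw, Filter.EventuallyEq.rfl⟩

lemma SameGerm.refl {x : ℍ[ℝ]} (hx : x ∈ Ω) : SameGerm Ω f x x := by
  obtain ⟨J₀⟩ := nonempty_imagUnits
  obtain ⟨J, hJ⟩ := exists_slicePoint x J₀
  exact ⟨hx, hx, J, J, foldHalf x, norm_nonneg _, hJ, hJ, Filter.EventuallyEq.rfl⟩

lemma SameGerm.symm {x y : ℍ[ℝ]} (h : SameGerm Ω f x y) : SameGerm Ω f y x := by
  obtain ⟨hx, hy, J, K, z, hz, hxJ, hyK, h⟩ := h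
  exact ⟨hy, hx, K, J, z, hz, hyK, hxJ, h.symm⟩

lemma SameGerm.eventuallyEq (hΩ : IsOpen Ω) (hf : IsSliceRegular Ω f) {J K : imagUnits} {z : ℂ}
    (hz : 0 ≤ z.im) (h : SameGerm Ω f (slicePoint J z) (slicePoint K z)) :
    stem f J =ᶠ[𝓝 z] stem f K := by
  obtain ⟨hx, hy, J', K', w, hw, hJ, hK, h⟩ := h
  obtain ⟨rfl, h1⟩ := stem_eventuallyEq_of_slicePoint_eq hΩ hf hz hw hx hJ
  obtain ⟨-, h2⟩ := stem_eventuallyEq_of_slicePoint_eq hΩ hf hz hw hy hK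
  exact (h1.trans h).trans h2.symm

lemma SameGerm.trans (hΩ : IsOpen Ω) (hf : IsSliceRegular Ω f) {x y u : ℍ[ℝ]}
    (h : SameGerm Ω f x y) (h' : SameGerm Ω f y u) : SameGerm Ω f x u := by
  obtain ⟨hx, hy, J, K, z, hz, hxJ, hyK, h⟩ := h
  obtain ⟨-, hu, K', L, w, hw, hyK', huL, h'⟩ := h'
  obtain ⟨rfl, h1⟩ := stem_eventuallyEq_of_slicePoint_eq hΩ hf hz hw (hyK ▸ hy)
    (hyK.symm.trans hyK')
  exact ⟨hx, hu, J, L, z, hz, hxJ, huL, (h.trans h1).trans h'⟩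

/-- The identity principle for `F^J - F^K` along a path in `E^{J,K}`. -/
lemma stem_eventuallyEq_of_joinedIn (hΩ : IsSpearedOpen Ω) (hf : IsSliceRegular Ω f)
    {J K : imagUnits} {z w : ℂ} (hzw : JoinedIn (halfDom₂ Ω J K) z w)
    (h : stem f J =ᶠ[𝓝 z] stem f K) : stem f J =ᶠ[𝓝 w] stem f K := by
  have hJ := isHolomorphicStem_stem hΩ hf J
  have hK := isHolomorphicStem_stem hΩ hf K
  have hO : IsOpen (stemDom Ω J ∩ stemDom Ω K) := hJ.isOpen.inter hK.isOpen
  have hJ' : HolomorphicWrt iotaCLM (stem f J) (stemDom Ω J) := ⟨hJ.contDiffOn, hJ.dbar_eq_zero⟩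
  have hK' : HolomorphicWrt iotaCLM (stem f K) (stemDom Ω K) := ⟨hK.contDiffOn, hK.dbar_eq_zero⟩
  have hsub : halfDom₂ Ω J K ⊆ stemDom Ω J ∩ stemDom Ω K :=
    Set.inter_subset_inter (halfDom_subset_stemDom Ω J) (halfDom_subset_stemDom Ω K)
  have hz := hsub hzw.source_mem
  have hw : w ∈ connectedComponentIn (stemDom Ω J ∩ stemDom Ω K) z :=
    (isPathConnected_pathComponentIn hz).isConnected.isPreconnected.subset_connectedComponentIn
      (mem_pathComponentIn_self hz) pathComponentIn_subset (hzw.mono hsub)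
  have hCO := hO.connectedComponentIn (x := z)
  have hzero := HolomorphicWrt.eqOn_zero iotaCLM_iotaCLM hCO isPreconnected_connectedComponentIn
    (((hJ'.mono Set.inter_subset_left).sub hO (hK'.mono Set.inter_subset_right)).mono
      (connectedComponentIn_subset _ z)) (mem_connectedComponentIn hz)
    (Filter.Eventually.frequently ((h.mono fun y hy => sub_eq_zero.2 hy).filter_mono
      nhdsWithin_le_nhds))
  filter_upwards [hCO.mem_nhds hw] with y hy
  exact sub_eq_zero.1 (hzero y hy)

lemma Shadows.sameGerm_iff (hΩ : IsSpearedOpen Ω) (hf : IsSliceRegular Ω f)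
    {x₁ y₁ x₀ y₀ : ℍ[ℝ]} (h : Shadows Ω x₁ y₁ x₀ y₀) :
    SameGerm Ω f x₀ x₁ ↔ SameGerm Ω f y₀ y₁ := by
  obtain ⟨J, K, z, w, hz, hw, rfl, rfl, rfl, rfl, h1, h2, h3, h4, hzw⟩ := h
  exact ⟨fun h => ⟨h3, h4, J, K, w, hw, rfl, rfl,
      stem_eventuallyEq_of_joinedIn hΩ hf hzw (h.eventuallyEq hΩ.1 hf hz)⟩,
    fun h => ⟨h1, h2, J, K, z, hz, rfl, rfl,
      stem_eventuallyEq_of_joinedIn hΩ hf hzw.symm (h.eventuallyEq hΩ.1 hf hw)⟩⟩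

lemma foldHalf_eq_of_mem_sphereThrough {x y : ℍ[ℝ]} (h : y ∈ sphereThrough x) :
    foldHalf y = foldHalf x := by
  obtain ⟨z, I, J, rfl, rfl⟩ := h
  simp [foldHalf, slicePoint_re, slicePoint_im, norm_smul, norm_imagUnits]

/-- Within `𝕊_x ∩ Ω` the germ is locally constant, because `J ↦ F^J` is. -/
lemma sameGerm_of_mem_connectedComponentIn (hΩ : IsSpearedOpen Ω) (hf : IsSliceRegular Ω f)
    {x y : ℍ[ℝ]} (h : y ∈ connectedComponentIn (sphereThrough x ∩ Ω) x) : SameGerm Ω f x y := by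
  have hx : x ∈ sphereThrough x ∩ Ω := connectedComponentIn_nonempty_iff.1 ⟨y, h⟩
  set C := connectedComponentIn (sphereThrough x ∩ Ω) x
  have hC : C ⊆ sphereThrough x ∩ Ω := connectedComponentIn_subset _ _
  refine isPreconnected_connectedComponentIn.induction₂' (SameGerm Ω f) (fun p hp => ?_)
    (fun _ _ _ _ _ _ => SameGerm.trans hΩ.1 hf) (mem_connectedComponentIn hx) h
  obtain ⟨J₀⟩ := nonempty_imagUnits
  obtain ⟨J, hJ⟩ := exists_slicePoint p J₀
  have hpJ : p ∈ adaptedSet Ω J := (isRepresentationSet_adaptedSet hΩ hf J).halfSlice_subset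
    ⟨(hC hp).2, foldHalf p, norm_nonneg _, hJ⟩
  filter_upwards [self_mem_nhdsWithin, nhdsWithin_le_nhds ((isOpen_adaptedSet Ω J).mem_nhds hpJ)]
    with q hq ⟨K, w, hw, hqK, ε, U, hU, hK, hwU⟩
  have hwp : foldHalf p = w := by
    rw [foldHalf_eq_of_mem_sphereThrough (hC hp).1, ← foldHalf_eq_of_mem_sphereThrough (hC hq).1,
      hqK, foldHalf_slicePoint K hw]
  rw [hwp] at hJ
  have hpq : SameGerm Ω f p q := by
    refine ⟨(hC hp).2, (hC hq).2, J, K, w, hw, hJ, hqK, ?_⟩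
    filter_upwards [hU.speared.1.mem_nhds hwU] with y hy
    exact (hU.stem_eq_stem hΩ.1 hf hK hy).symm
  exact ⟨hpq, hpq.symm⟩

lemma SimpleCondition.sameGerm (hΩ : IsSpearedOpen Ω) (hf : IsSliceRegular Ω f) {p q : ℍ[ℝ]}
    (h : SimpleCondition Ω p q) : SameGerm Ω f p q := by
  rcases h with h | ⟨a, ha, h⟩
  · exact sameGerm_of_mem_connectedComponentIn hΩ hf h
  · exact (h.sameGerm_iff hΩ hf).2 (SameGerm.refl ha)

lemma SimpleStep.sameGerm (hΩ : IsSpearedOpen Ω) (hf : IsSliceRegular Ω f) {t : ℕ} {x : ℕ → ℍ[ℝ]}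
    {s : ℕ} (h : SimpleStep Ω t x s) : SameGerm Ω f (x s) (x (s + 1)) := by
  obtain ⟨i, j, -, -, rfl | rfl, rfl, h⟩ := h
  · rw [min_eq_left (Nat.le_succ i)]
    exact h.sameGerm hΩ hf
  · rw [min_eq_right (Nat.le_succ j)]
    exact (h.sameGerm hΩ hf).symm

/-- A double step at `(lo, hi)` transfers equality of germs between `x (lo + 1)` and `x hi` to
equality of germs between `x lo` and `x (hi + 1)`, whichever of the two pairs shadows the other. -/
lemma DoubleStep.sameGerm (hΩ : IsSpearedOpen Ω) (hf : IsSliceRegular Ω f) {t : ℕ} {x : ℕ → ℍ[ℝ]}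
    {lo hi : ℕ} (h : DoubleStep Ω t x lo hi) :
    lo < hi ∧ (SameGerm Ω f (x (lo + 1)) (x hi) → SameGerm Ω f (x lo) (x (hi + 1))) := by
  obtain ⟨s, s', r, r', -, -, -, -, hs, -, h1, h2, h3, h4, hr, hsh, hlo, hhi⟩ := h
  have key := hsh.sameGerm_iff hΩ hf (f := f)
  rcases hs with rfl | rfl
  · obtain rfl : r = r' + 1 := by omega
    rcases lt_or_ge s r' with hlt | hge
    · obtain ⟨rfl, rfl⟩ : lo = s ∧ hi = r' := by omega
      exact ⟨hlt, key.2⟩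
    · obtain ⟨rfl, rfl⟩ : lo = r' ∧ hi = s := by omega
      exact ⟨by omega, fun h => (key.1 h.symm).symm⟩
  · obtain rfl : r' = r + 1 := by omega
    rcases lt_or_ge s' r with hlt | hge
    · obtain ⟨rfl, rfl⟩ : lo = s' ∧ hi = r := by omega
      exact ⟨hlt, key.1⟩
    · obtain ⟨rfl, rfl⟩ : lo = r ∧ hi = s' := by omega
      exact ⟨by omega, fun h => (key.2 h.symm).symm⟩

end Hinged

/-- Induction along properly nested brackets `(lo m, hi m)`: if a relation holds across every
position outside the brackets, and passes from the inside to the outside of every bracket, then it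
holds between the ends of every interval that no bracket straddles. -/
theorem rel_of_nested_brackets {R : ℕ → ℕ → Prop} {t ℓ : ℕ} {lo hi : Fin ℓ → ℕ}
    (hrefl : ∀ i ≤ t, R i i) (htrans : ∀ i j k, R i j → R j k → R i k)
    (hlt : ∀ m, lo m < hi m) (hmono : StrictMono lo)
    (hnest : ∀ m n, m < n → hi m < lo n ∨ hi n < hi m)
    (hstep : ∀ i < t, (∀ m, lo m ≠ i ∧ hi m ≠ i) → R i (i + 1))
    (hbracket : ∀ m, R (lo m + 1) (hi m) → R (lo m) (hi m + 1)) {i j : ℕ} (hij : i ≤ j)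
    (hjt : j ≤ t)
    (hbal : ∀ m, (i ≤ lo m ∧ lo m < j) ↔ (i ≤ hi m ∧ hi m < j)) : R i j := by
  have hcmp : ∀ m n, lo m < lo n → hi m < lo n ∨ hi n < hi m := fun m n h =>
    hnest m n (hmono.lt_iff_lt.1 h)
  have hinj : ∀ m n, lo m = lo n → hi m = hi n := fun m n h => by rw [hmono.injective h]
  induction hd : j - i using Nat.strong_induction_on generalizing i j with
  | _ d ih =>
    rcases hij.eq_or_lt with rfl | hij'
    · exact hrefl i hjt
    by_cases hi' : ∀ m, lo m ≠ i ∧ hi m ≠ i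
    · refine htrans _ (i + 1) _ (hstep i (hij'.trans_le hjt) hi')
        (ih (j - (i + 1)) (by omega) hij' hjt (fun m => ?_) rfl)
      have h1 := hi' m
      have h2 := hbal m
      omega
    · push Not at hi'
      obtain ⟨m, hm⟩ := hi'
      have hlo : lo m = i := by
        by_contra hne
        have h1 := hm hne
        have h2 := hbal m
        have h3 := hlt m
        omega
      have hb := hbal m
      have hl := hlt m
      have hinner : R (lo m + 1) (hi m) := by
        refine ih (hi m - (lo m + 1)) (by omega) (by omega) (by omega) (fun n => ?_) rfl
        have h1 := hlt n
        have h2 := hinj m n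
        rcases lt_trichotomy (lo m) (lo n) with h | h | h
        · have := hcmp m n h; omega
        · omega
        · have := hcmp n m h; omega
      refine htrans _ (hi m + 1) _ (hlo ▸ hbracket m hinner)
        (ih (j - (hi m + 1)) (by omega) (by omega) hjt (fun n => ?_) rfl)
      have h1 := hlt n
      have h2 := hinj m n
      have h3 := hbal n
      rcases lt_trichotomy (lo m) (lo n) with h | h | h
      · have := hcmp m n h; omega
      · omega
      · omega

theorem Hinged.sameGerm {Ω : Set ℍ[ℝ]} {f : ℍ[ℝ] → ℍ[ℝ]} (hΩ : IsSpearedOpen Ω)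
    (hf : IsSliceRegular Ω f) {x x' : ℍ[ℝ]} (h : Hinged Ω x x') : SameGerm Ω f x x' := by
  obtain ⟨t, c, ⟨-, hmem, ℓ, lo, hi, -, hrange, hdouble, hmono, hnest⟩, rfl, rfl⟩ := h
  have hlo : ∀ m, lo m < t := fun m => (hrange.subset ⟨Sum.inl m, rfl⟩ : lo m ∈ _).1
  have hhi : ∀ m, hi m < t := fun m => (hrange.subset ⟨Sum.inr m, rfl⟩ : hi m ∈ _).1
  refine rel_of_nested_brackets (R := fun i j => SameGerm Ω f (c i) (c j)) (t := t)
    (fun i hi => SameGerm.refl (hmem i hi)) (fun _ _ _ => SameGerm.trans hΩ.1 hf)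
    (fun m => ((hdouble m).sameGerm hΩ hf (f := f)).1) hmono hnest (fun i hit hi' => ?_)
    (fun m => ((hdouble m).sameGerm hΩ hf).2) (Nat.zero_le t) le_rfl
    (fun m => by simp [hlo m, hhi m])
  by_contra hns
  have hmem : i ∈ Set.range (Sum.elim lo hi) := by
    rw [hrange]
    exact ⟨hit, fun hs => hns (hs.sameGerm hΩ hf)⟩
  obtain ⟨m | m, hm⟩ := hmem
  · exact (hi' m).1 hm
  · exact (hi' m).2 hm

end

theorem theorem5 (Ω : Set ℍ[ℝ]) (f : ℍ[ℝ] → ℍ[ℝ])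
    (hΩ : IsSpearedDomain Ω) (hf : IsSliceRegular Ω f) :
    -- the objects of the theorem are well defined
    (IsHolomorphicStemFamily Ω f (stem f) ∧
      (∀ x ∈ Ω, ∃! v, IsSphericalValue Ω f x v) ∧
      (∀ x ∈ Ω, x ∉ Set.range (fun a : ℝ => (a : ℍ[ℝ])) →
        ∃! v, IsSphericalDerivative Ω f x v)) ∧
    -- the theorem on hinged points
    ∀ (α₀ β₀ : ℝ) (I I' : imagUnits), 0 ≤ β₀ →
      slicePoint I ⟨α₀, β₀⟩ ∈ Ω → slicePoint I' ⟨α₀, β₀⟩ ∈ Ω →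
      Hinged Ω (slicePoint I ⟨α₀, β₀⟩) (slicePoint I' ⟨α₀, β₀⟩) →
      ∃ U : Set ℂ, IsOpen U ∧ (⟨α₀, β₀⟩ : ℂ) ∈ U ∧ U ⊆ stemDom₂ Ω I I' ∧
        Set.EqOn (stem f I) (stem f I') U ∧
        ∀ α β : ℝ, 0 ≤ β → (⟨α, β⟩ : ℂ) ∈ U →
          sphericalValue Ω f (slicePoint I ⟨α, β⟩) =
              sphericalValue Ω f (slicePoint I' ⟨α, β⟩) ∧
            (0 < β →
              sphericalDerivative Ω f (slicePoint I ⟨α, β⟩) =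
                sphericalDerivative Ω f (slicePoint I' ⟨α, β⟩)) := by
  refine ⟨⟨isHolomorphicStemFamily_stem hΩ.2 hf,
    fun x hx => existsUnique_isSphericalValue hΩ.2 hf hx,
    fun x hx hxr => existsUnique_isSphericalDerivative hΩ.2 hf hx hxr⟩, ?_⟩
  intro α₀ β₀ I I' hβ₀ hI hI' hh
  have heq : stem f I =ᶠ[𝓝 ⟨α₀, β₀⟩] stem f I' :=
    (hh.sameGerm hΩ.2 hf).eventuallyEq hΩ.2.1 hf hβ₀
  obtain ⟨V, hV, hVO, hzV⟩ := eventually_nhds_iff.1 heq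
  have hstem := isHolomorphicStem_stem hΩ.2 hf
  refine ⟨V ∩ (stemDom Ω I ∩ stemDom Ω I'), hVO.inter ((hstem I).isOpen.inter (hstem I').isOpen),
    ⟨hzV, Or.inl (mem_halfDom.2 ⟨hI, hβ₀⟩), Or.inl (mem_halfDom.2 ⟨hI', hβ₀⟩)⟩,
    (stemDom₂_eq Ω I I').symm ▸ Set.inter_subset_right, fun z hz => hV z hz.1, ?_⟩
  rintro α β hβ ⟨hzV, hzI, hzI'⟩
  have h1 := mem_halfDom_of_mem_stemDom hzI hβ
  have h2 := mem_halfDom_of_mem_stemDom hzI' hβ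
  refine ⟨?_, fun hpos => ?_⟩
  · rw [sphericalValue_eq hΩ.2 hf h1, sphericalValue_eq hΩ.2 hf h2, hV _ hzV]
  · rw [sphericalDerivative_eq hΩ.2 hf h1 hpos, sphericalDerivative_eq hΩ.2 hf h2 hpos, hV _ hzV]
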